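/- Let $\mathbb F=a_0x_1^4+4a_1x_1^3x_2+6a_2x_1^2x_2^2+4a_3x_1x_2^3+a_4x_2^4$ be the generic binary quartic over $R=\mathbb C[a_0,\dots,a_4]$. For binary forms $A,B$ of orders $m,n$ and $r\le\min\{m,n\}$ put $$(A,B)_r=\frac{(m-r)!\,(n-r)!}{m!\,n!}\sum_{k=0}^r(-1)^k\binom rk\frac{\partial^rA}{\partial x_1^{r-k}\partial x_2^k}\,\frac{\partial^rB}{\partial x_1^k\partial x_2^{r-k}},$$ and let $\mathbb H=(\mathbb F,\mathbb F)_2$, $\mathbb T=(\mathbb F,\mathbb H)_1$, $i=(\mathbb F,\mathbb F)_4\in R$, $j=(\mathbb F,\mathbb H)_4\in R$. Let $\Delta\in R$ be the discriminant of $\mathbb F$, regarded as defined up to a nonzero constant factor, and let $J=(\partial\Delta/\partial a_0,\dots,\partial\Delta/\partial a_4)\subseteq R$ be its Jacobian ideal. For an invariant $I\in R$ of degree $m$ let $\mathcal E_I=\frac1m\sum_{k=0}^4\frac{\partial I}{\partial a_k}x_2^{4-k}(-x_1)^k$ be its evectant. For a partition $\lambda=(\lambda_1,\dots,\lambda_n)$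 of $4$ let $X_\lambda\subseteq\mathbb P^4$ be the set of points $[\alpha_0,\dots,\alpha_4]$ such that $\sum_k\binom4k\alpha_kx_1^{4-k}x_2^k=\prod_{s} l_s^{\lambda_s}$ for some linear forms $l_s$ over $\mathbb C$. Let $\mathfrak P_\tau,\mathfrak P_\delta\subseteq R$ be the homogeneous ideals of $X_{(3,1)}$ and $X_{(2,2)}$. **(a1)** Up to a nonzero constant factor $\Delta=i^3-6j^2$; and, for $\Delta$ normalised so that equality holds, $\mathcal E_\Delta=i^2\,\mathbb F-6j\,\mathbb H$. **(a2)** $\mathfrak P_\tau=(i,j)$, and $i,j$ is a regular sequence in $R$ (so $\mathfrak P_\tau$ is a complete intersection ideal); $\mathfrak P_\delta$ is the ideal generated by the coefficients of $\mathbb T$. **(a3)** $J=(i^2,j)\cap\mathfrak P_\delta$ is an irredundant primary decomposition: $\mathfrak P_\tau$ and $\mathfrak P_\delta$ are prime, $(i^2,j)$ is $\mathfrak P_\tau$-primary, and neither of $(i^2,j)$, $\mathfrak P_\delta$ contains the other. -/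

import Mathlib

open MvPolynomial

noncomputable section

namespace BinaryForms

/-- The binary form `∑ (d choose k) a_k x₁^(d-k) x₂^k` of order `d` with coefficient vector `a`.
The variables `x₁, x₂` are `X 0, X 1`. -/
def binaryForm {K : Type*} [CommSemiring K] (d : ℕ) (a : Fin (d + 1) → K) :
    MvPolynomial (Fin 2) K :=
  ∑ k : Fin (d + 1), C ((d.choose k : K) * a k) * X 0 ^ (d - (k : ℕ)) * X 1 ^ (k : ℕ)

/-- The coefficient ring `R = ℂ[a₀, …, a_d]`. -/
abbrev CoeffRing (d : ℕ) : Type := MvPolynomial (Fin (d + 1)) ℂ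

/-- The generic binary form of order `d`, whose coefficients are the variables of `R`. -/
def genericForm (d : ℕ) : MvPolynomial (Fin 2) (CoeffRing d) := binaryForm d X

/-- `∂^(p+q) A / ∂x₁^p ∂x₂^q`. -/
def partialDeriv {K : Type*} [CommSemiring K] (p q : ℕ) (A : MvPolynomial (Fin 2) K) :
    MvPolynomial (Fin 2) K :=
  (pderiv 0)^[p] ((pderiv 1)^[q] A)

/-- The `r`-th transvectant `(A, B)_r` of binary forms `A`, `B` of orders `m`, `n`. -/
def transvectant {K : Type*} [CommRing K] [Algebra ℚ K] (m n r : ℕ)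
    (A B : MvPolynomial (Fin 2) K) : MvPolynomial (Fin 2) K :=
  if r ≤ min m n then
    C (algebraMap ℚ K
        (((m - r).factorial * (n - r).factorial : ℚ) / (m.factorial * n.factorial : ℚ))) *
      ∑ k ∈ Finset.range (r + 1),
        (-1) ^ k * (r.choose k : MvPolynomial (Fin 2) K) *
          partialDeriv (r - k) k A * partialDeriv k (r - k) B
  else 0

/-- The Hessian `H = (F, F)₂` of the generic form, of order `2d - 4`. -/
def hessian (d : ℕ) : MvPolynomial (Fin 2) (CoeffRing d) :=
  transvectant d d 2 (genericForm d) (genericForm d)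

/-- The cubicovariant `T = (F, H)₁` of the generic form, of order `3d - 6`. -/
def cubicovariant (d : ℕ) : MvPolynomial (Fin 2) (CoeffRing d) :=
  transvectant d (2 * d - 4) 1 (genericForm d) (hessian d)

/-- The invariant `i = (F, F)₄` of the generic quartic: the form `(F, F)₄` has order `0`,
and is identified with its constant coefficient. -/
def invI : CoeffRing 4 := constantCoeff (transvectant 4 4 4 (genericForm 4) (genericForm 4))

/-- The invariant `j = (F, H)₄` of the generic quartic (again a form of order `0`). -/
def invJ : CoeffRing 4 := constantCoeff (transvectant 4 4 4 (genericForm 4) (hessian 4))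

/-- The discriminant of the generic binary form `F` of order `d`, as the discriminant of the
generic polynomial `F(x, 1)` of degree `d` in one variable. -/
def discriminant (d : ℕ) : CoeffRing d :=
  (aeval ![(Polynomial.X : Polynomial (CoeffRing d)), 1] (genericForm d)).discr

/-- The evectant of an invariant `I` of degree `m` of binary forms of order `d`. -/
def evectant (d m : ℕ) (I : CoeffRing d) : MvPolynomial (Fin 2) (CoeffRing d) :=
  C (C ((-1) ^ d / (m : ℂ))) *
    ∑ k : Fin (d + 1), C (pderiv k I) * X 1 ^ (d - (k : ℕ)) * (-X 0) ^ (k : ℕ)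

/-- The Jacobian ideal of a polynomial: the ideal generated by its first partial derivatives. -/
def jacobianIdeal {d : ℕ} (D : CoeffRing d) : Ideal (CoeffRing d) :=
  Ideal.span (Set.range fun k : Fin (d + 1) => pderiv k D)

/-- The ideal of `R` generated by the coefficients of a form over `R`. -/
def coeffIdeal {d : ℕ} (A : MvPolynomial (Fin 2) (CoeffRing d)) : Ideal (CoeffRing d) :=
  Ideal.span (Set.range fun s : Fin 2 →₀ ℕ => coeff s A)

/-- The coincident root locus `X_lam ⊆ ℙ^d` of a partition `lam` of `d` into `n` parts: the points
`[α₀, …, α_d]` whose form is `∏ l_k ^ lam_k` for some linear forms `l_k`. -/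
def coincidentRootLocus (d : ℕ) {n : ℕ} (lam : Fin n → ℕ) :
    Set (Projectivization ℂ (Fin (d + 1) → ℂ)) :=
  {P | ∃ (v : Fin (d + 1) → ℂ) (hv : v ≠ 0), Projectivization.mk ℂ v hv = P ∧
    ∃ l : Fin n → MvPolynomial (Fin 2) ℂ, (∀ k, (l k).IsHomogeneous 1) ∧
      binaryForm d v = ∏ k, l k ^ lam k}

/-- The homogeneous ideal of a subset of `ℙ^d`, generated by the homogeneous polynomials that
vanish at all its points. -/
def projectiveIdeal {d : ℕ} (S : Set (Projectivization ℂ (Fin (d + 1) → ℂ))) :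
    Ideal (CoeffRing d) :=
  Ideal.span {f | (∃ m : ℕ, f.IsHomogeneous m) ∧
    ∀ (v : Fin (d + 1) → ℂ) (hv : v ≠ 0), Projectivization.mk ℂ v hv ∈ S → eval v f = 0}

end BinaryForms

end

/-!
The ideals of the two coincident root loci are computed as kernels of the ring homomorphisms
`tangentPullback` and `squarePullback` to `ℂ[X₀, X₁, X₂]` given by dominant parametrisations; being
kernels of maps to a domain, they are prime.

*Triple roots.* Up to a power of `a₀`, every polynomial is congruent modulo `(i, j)` to `p + q G`,
where `p, q` are polynomials in the seminvariants `a₀, a₁, H = a₀ a₂ - a₁²` and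
`G = a₀² a₃ - 3 a₀ a₁ a₂ + 2 a₁³` is the leading coefficient of `T`; the classical syzygy reads
`G² = -4 H³` there (`exists_seminvariantSubst`). On the quartics with a triple root this forces
`p = q = 0`. As `a₀` is not a zero divisor modulo `(i, j)` (`mem_span_pair_of_X_zero_pow_mul_mem`),
the kernel is `(i, j)` (`ker_tangentPullback`). Primality of `i` gives the regular sequence and the
primary ideal `(i², j)`.

*Squares.* For the square `3 (p x₁² + 2 q x₁ x₂ + r x₂²)²` put `z = p r`. The ring modulo the
coefficients of `T` is generated over `ℂ[a₀, a₂, a₄]` by `1, a₁, a₃` and quadrics representing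
`9 z a₀, 9 z a₂, 9 z a₄` (`exists_normalForm`). As `1, p q, q r, p r` are independent over
`ℂ[a₀, a₂, a₄]`, the only relations come from the Koszul syzygies, and these are again coefficients
of `T` (`ker_squarePullback`).

*The Jacobian ideal.* The discriminant is `32 (i³ - 6 j²)`, and its partial derivatives are the
coefficients of `i² F - 6 j H`. Their first transvectant with `F` shows that `j` times a coefficient
of `T` is in the Jacobian ideal (`invJ_mul_mem_jacobianIdeal`). On squares `i` and `j` are multiples
of `d²` and `d³` with `d = p r - q²`, so if `u i² + v j` vanishes there, then `v = -12 d u`. Since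
`d` is not a linear combination of the coefficients, `u` has no constant term, and `u i²` is a
multiple of `j` modulo the Jacobian ideal (`jacobianIdeal_eq_inf`).
-/

noncomputable section

namespace BinaryForms

/-! ### Derivatives of binary forms -/

section Derivatives
variable {K : Type*} [CommRing K]

lemma pderiv_zero_binaryForm (d : ℕ) (a : Fin (d + 2) → K) :
    pderiv 0 (binaryForm (d + 1) a) = C ((d : K) + 1) * binaryForm d (fun k => a k.castSucc) := by
  simp only [binaryForm]
  rw [Fin.sum_univ_castSucc, map_add, map_sum, Finset.mul_sum]
  have h : pderiv 0 (C (((d + 1).choose (Fin.last (d + 1) : ℕ) : K) * a (Fin.last (d + 1))) *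
      X 0 ^ (d + 1 - (Fin.last (d + 1) : ℕ)) * X 1 ^ (Fin.last (d + 1) : ℕ) :
      MvPolynomial (Fin 2) K) = 0 := by
    simp [Derivation.leibniz, Derivation.leibniz_pow, pderiv_X]
  rw [h, add_zero]
  refine Finset.sum_congr rfl fun k _ => ?_
  have hk : (k : ℕ) ≤ d := Nat.lt_succ_iff.mp k.2
  have hc := congrArg (fun n : ℕ => (n : K)) (Nat.choose_mul_succ_eq d k)
  obtain ⟨e, he⟩ := Nat.exists_eq_add_of_le hk
  have h1 : d + 1 - (k : ℕ) = e + 1 := by omega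
  have h2 : d - (k : ℕ) = e := by omega
  simp only [h1] at hc
  simp only [Fin.val_castSucc, h1, h2]
  push_cast at hc
  have hc' := congrArg (C : K → MvPolynomial (Fin 2) K) hc
  simp [Derivation.leibniz, Derivation.leibniz_pow, pderiv_X] at hc' ⊢
  linear_combination (-C (a k.castSucc) * X 0 ^ e * X 1 ^ (k : ℕ)) * hc'

lemma pderiv_one_binaryForm (d : ℕ) (a : Fin (d + 2) → K) :
    pderiv 1 (binaryForm (d + 1) a) = C ((d : K) + 1) * binaryForm d (fun k => a k.succ) := by
  simp only [binaryForm]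
  rw [Fin.sum_univ_succ, map_add, map_sum, Finset.mul_sum]
  have h : pderiv 1 (C (((d + 1).choose ((0 : Fin (d + 2)) : ℕ) : K) * a 0) *
      X 0 ^ (d + 1 - ((0 : Fin (d + 2)) : ℕ)) * X 1 ^ ((0 : Fin (d + 2)) : ℕ) :
      MvPolynomial (Fin 2) K) = 0 := by
    simp [Derivation.leibniz, Derivation.leibniz_pow, pderiv_X]
  rw [h, zero_add]
  refine Finset.sum_congr rfl fun k _ => ?_
  have hc := congrArg (fun n : ℕ => (n : K)) (Nat.add_one_mul_choose_eq d k)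
  have h1 : d + 1 - ((k : ℕ) + 1) = d - k := by omega
  simp only [Fin.val_succ, h1]
  push_cast at hc
  have hc' := congrArg (C : K → MvPolynomial (Fin 2) K) hc
  simp [Derivation.leibniz, Derivation.leibniz_pow, pderiv_X] at hc' ⊢
  linear_combination (-C (a k.succ) * X 0 ^ (d - (k : ℕ)) * X 1 ^ (k : ℕ)) * hc'

lemma binaryForm_four (a : Fin 5 → K) : binaryForm 4 a =
    C (a 0) * X 0 ^ 4 + 4 * C (a 1) * X 0 ^ 3 * X 1 + 6 * C (a 2) * X 0 ^ 2 * X 1 ^ 2 +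
      4 * C (a 3) * X 0 * X 1 ^ 3 + C (a 4) * X 1 ^ 4 := by
  simp [binaryForm, Fin.sum_univ_succ, Nat.choose, Fin.succ]
  ring

end Derivatives

/-! ### Transvectants of binary quartics -/

section Transvectants
variable {K : Type*} [CommRing K]

lemma pderiv_zero_quartic (a : Fin 5 → K) :
    pderiv 0 (binaryForm 4 a) = 4 * binaryForm 3 ![a 0, a 1, a 2, a 3] := by
  have hc : ((3 : ℕ) : K) + 1 = 4 := by norm_num
  have hv : (fun k : Fin 4 => a k.castSucc) = ![a 0, a 1, a 2, a 3] := by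
    ext k; fin_cases k <;> rfl
  rw [pderiv_zero_binaryForm 3 a, hc, hv, map_ofNat]

lemma pderiv_one_quartic (a : Fin 5 → K) :
    pderiv 1 (binaryForm 4 a) = 4 * binaryForm 3 ![a 1, a 2, a 3, a 4] := by
  have hc : ((3 : ℕ) : K) + 1 = 4 := by norm_num
  have hv : (fun k : Fin 4 => a k.succ) = ![a 1, a 2, a 3, a 4] := by
    ext k; fin_cases k <;> rfl
  rw [pderiv_one_binaryForm 3 a, hc, hv, map_ofNat]

lemma pderiv_zero_cubic (a : Fin 4 → K) :
    pderiv 0 (binaryForm 3 a) = 3 * binaryForm 2 ![a 0, a 1, a 2] := by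
  have hc : ((2 : ℕ) : K) + 1 = 3 := by norm_num
  have hv : (fun k : Fin 3 => a k.castSucc) = ![a 0, a 1, a 2] := by
    ext k; fin_cases k <;> rfl
  rw [pderiv_zero_binaryForm 2 a, hc, hv, map_ofNat]

lemma pderiv_one_cubic (a : Fin 4 → K) :
    pderiv 1 (binaryForm 3 a) = 3 * binaryForm 2 ![a 1, a 2, a 3] := by
  have hc : ((2 : ℕ) : K) + 1 = 3 := by norm_num
  have hv : (fun k : Fin 3 => a k.succ) = ![a 1, a 2, a 3] := by
    ext k; fin_cases k <;> rfl
  rw [pderiv_one_binaryForm 2 a, hc, hv, map_ofNat]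

lemma pderiv_zero_quadratic (a : Fin 3 → K) :
    pderiv 0 (binaryForm 2 a) = 2 * binaryForm 1 ![a 0, a 1] := by
  have hc : ((1 : ℕ) : K) + 1 = 2 := by norm_num
  have hv : (fun k : Fin 2 => a k.castSucc) = ![a 0, a 1] := by
    ext k; fin_cases k <;> rfl
  rw [pderiv_zero_binaryForm 1 a, hc, hv, map_ofNat]

lemma pderiv_one_quadratic (a : Fin 3 → K) :
    pderiv 1 (binaryForm 2 a) = 2 * binaryForm 1 ![a 1, a 2] := by
  have hc : ((1 : ℕ) : K) + 1 = 2 := by norm_num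
  have hv : (fun k : Fin 2 => a k.succ) = ![a 1, a 2] := by
    ext k; fin_cases k <;> rfl
  rw [pderiv_one_binaryForm 1 a, hc, hv, map_ofNat]

lemma binaryForm_one (a : Fin 2 → K) : binaryForm 1 a = C (a 0) * X 0 + C (a 1) * X 1 := by
  simp [binaryForm, Fin.sum_univ_succ]

lemma binaryForm_two (a : Fin 3 → K) : binaryForm 2 a =
    C (a 0) * X 0 ^ 2 + 2 * C (a 1) * X 0 * X 1 + C (a 2) * X 1 ^ 2 := by
  simp [binaryForm, Fin.sum_univ_succ, Nat.choose, Fin.succ]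
  ring

lemma binaryForm_three (a : Fin 4 → K) : binaryForm 3 a =
    C (a 0) * X 0 ^ 3 + 3 * C (a 1) * X 0 ^ 2 * X 1 + 3 * C (a 2) * X 0 * X 1 ^ 2 +
      C (a 3) * X 1 ^ 3 := by
  simp [binaryForm, Fin.sum_univ_succ, Nat.choose, Fin.succ]
  ring

lemma C_ofNat (n : ℕ) [n.AtLeastTwo] :
    (C (ofNat(n) : K) : MvPolynomial (Fin 2) K) = ofNat(n) :=
  map_ofNat C n

lemma pderiv_const_mul (i : Fin 2) (n : ℕ) [n.AtLeastTwo] (A : MvPolynomial (Fin 2) K) :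
    pderiv i (ofNat(n) * A) = ofNat(n) * pderiv i A := by
  rw [show (ofNat(n) : MvPolynomial (Fin 2) K) = C (ofNat(n)) from
    (C_ofNat n).symm, pderiv_C_mul]

variable [Algebra ℚ K]

lemma C_algebraMap_mul_ofNat {q : ℚ} (n : ℕ) [n.AtLeastTwo] (h : q * ofNat(n) = 1) :
    (C (algebraMap ℚ K q) : MvPolynomial (Fin 2) K) * ofNat(n) = 1 := by
  rw [← map_ofNat (C : K →+* MvPolynomial (Fin 2) K) n, ← map_mul,
    ← map_ofNat (algebraMap ℚ K), ← map_mul, h, map_one, map_one]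

lemma transvectant_four_four_four (a b : Fin 5 → K) :
    transvectant 4 4 4 (binaryForm 4 a) (binaryForm 4 b) =
      C (a 0 * b 4 - 4 * a 1 * b 3 + 6 * a 2 * b 2 - 4 * a 3 * b 1 + a 4 * b 0) := by
  have h := C_algebraMap_mul_ofNat (K := K) (q := ((4 - 4).factorial * (4 - 4).factorial : ℚ) /
    (Nat.factorial 4 * Nat.factorial 4 : ℚ)) 576 (by norm_num [Nat.factorial])
  rw [transvectant, if_pos (by norm_num)]
  generalize (C (algebraMap ℚ K (((4 - 4).factorial * (4 - 4).factorial : ℚ) /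
    (Nat.factorial 4 * Nat.factorial 4 : ℚ))) : MvPolynomial (Fin 2) K) = q at *
  simp only [Finset.sum_range_succ, Finset.sum_range_zero, partialDeriv, Function.iterate_succ,
    Function.iterate_zero, Function.comp, id, Nat.reduceSub, Nat.reduceAdd, Nat.choose,
    pderiv_zero_quartic, pderiv_one_quartic, pderiv_const_mul, pderiv_zero_cubic,
    pderiv_one_cubic, pderiv_zero_quadratic, pderiv_one_quadratic, binaryForm_one]
  simp [C_ofNat]
  linear_combination (C (a 0) * C (b 4) - 4 * C (a 1) * C (b 3) + 6 * C (a 2) * C (b 2) -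
    4 * C (a 3) * C (b 1) + C (a 4) * C (b 0)) * h

lemma transvectant_four_four_two (a : Fin 5 → K) :
    transvectant 4 4 2 (binaryForm 4 a) (binaryForm 4 a) =
      binaryForm 4 ![2 * (a 0 * a 2 - a 1 ^ 2), a 0 * a 3 - a 1 * a 2,
        algebraMap ℚ K (1 / 3) * (a 0 * a 4 + 2 * a 1 * a 3 - 3 * a 2 ^ 2),
        a 1 * a 4 - a 2 * a 3, 2 * (a 2 * a 4 - a 3 ^ 2)] := by
  have h := C_algebraMap_mul_ofNat (K := K) (q := ((4 - 2).factorial * (4 - 2).factorial : ℚ) /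
    (Nat.factorial 4 * Nat.factorial 4 : ℚ)) 144 (by norm_num [Nat.factorial])
  have h3 := C_algebraMap_mul_ofNat (K := K) (q := 1 / 3) 3 (by norm_num)
  rw [transvectant, if_pos (by norm_num)]
  generalize (C (algebraMap ℚ K (((4 - 2).factorial * (4 - 2).factorial : ℚ) /
    (Nat.factorial 4 * Nat.factorial 4 : ℚ))) : MvPolynomial (Fin 2) K) = q at *
  simp only [Finset.sum_range_succ, Finset.sum_range_zero, partialDeriv, Function.iterate_succ,
    Function.iterate_zero, Function.comp, id, Nat.reduceSub, Nat.reduceAdd, Nat.choose,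
    pderiv_zero_quartic, pderiv_one_quartic, pderiv_const_mul, pderiv_zero_cubic,
    pderiv_one_cubic, binaryForm_two]
  simp only [binaryForm_four]
  generalize algebraMap ℚ K (1 / 3) = c at *
  simp [C_ofNat]
  generalize C (a 0) = a0 at *
  generalize C (a 1) = a1 at *
  generalize C (a 2) = a2 at *
  generalize C (a 3) = a3 at *
  generalize C (a 4) = a4 at *
  linear_combination (2 * (a0 * X 0 ^ 2 + 2 * a1 * X 0 * X 1 + a2 * X 1 ^ 2) *
    (a2 * X 0 ^ 2 + 2 * a3 * X 0 * X 1 + a4 * X 1 ^ 2) -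
     2 * (a1 * X 0 ^ 2 + 2 * a2 * X 0 * X 1 + a3 * X 1 ^ 2) ^ 2) * h -
     2 * (a0 * a4 + 2 * a1 * a3 - 3 * a2 ^ 2) * X 0 ^ 2 * X 1 ^ 2 * h3

/-- The coefficients, without binomial factors, of the first transvectant of the quartics with
coefficient vectors `a` and `b`. -/
def firstTransvectantCoeff (a b : Fin 5 → K) : Fin 7 → K :=
  ![a 0 * b 1 - a 1 * b 0, 3 * (a 0 * b 2 - a 2 * b 0),
    3 * (a 0 * b 3 + 2 * a 1 * b 2 - 2 * a 2 * b 1 - a 3 * b 0),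
    a 0 * b 4 + 8 * a 1 * b 3 - 8 * a 3 * b 1 - a 4 * b 0,
    3 * (a 1 * b 4 + 2 * a 2 * b 3 - 2 * a 3 * b 2 - a 4 * b 1),
    3 * (a 2 * b 4 - a 4 * b 2), a 3 * b 4 - a 4 * b 3]

lemma transvectant_four_four_one (a b : Fin 5 → K) :
    transvectant 4 4 1 (binaryForm 4 a) (binaryForm 4 b) =
      ∑ k : Fin 7, C (firstTransvectantCoeff a b k) * X 0 ^ (6 - (k : ℕ)) * X 1 ^ (k : ℕ) := by
  have h := C_algebraMap_mul_ofNat (K := K) (q := ((4 - 1).factorial * (4 - 1).factorial : ℚ) /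
    (Nat.factorial 4 * Nat.factorial 4 : ℚ)) 16 (by norm_num [Nat.factorial])
  rw [transvectant, if_pos (by norm_num)]
  generalize (C (algebraMap ℚ K (((4 - 1).factorial * (4 - 1).factorial : ℚ) /
    (Nat.factorial 4 * Nat.factorial 4 : ℚ))) : MvPolynomial (Fin 2) K) = q at *
  simp only [Finset.sum_range_succ, Finset.sum_range_zero, partialDeriv, Function.iterate_succ,
    Function.iterate_zero, Function.comp, id, Nat.reduceSub, Nat.reduceAdd, Nat.choose,
    pderiv_zero_quartic, pderiv_one_quartic, binaryForm_three]
  simp [firstTransvectantCoeff, Fin.sum_univ_succ, Fin.succ, C_ofNat]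
  generalize C (a 0) = a0 at *
  generalize C (a 1) = a1 at *
  generalize C (a 2) = a2 at *
  generalize C (a 3) = a3 at *
  generalize C (a 4) = a4 at *
  generalize C (b 0) = b0 at *
  generalize C (b 1) = b1 at *
  generalize C (b 2) = b2 at *
  generalize C (b 3) = b3 at *
  generalize C (b 4) = b4 at *
  linear_combination
    ((a0 * X 0 ^ 3 + 3 * a1 * X 0 ^ 2 * X 1 + 3 * a2 * X 0 * X 1 ^ 2 + a3 * X 1 ^ 3) *
    (b1 * X 0 ^ 3 + 3 * b2 * X 0 ^ 2 * X 1 + 3 * b3 * X 0 * X 1 ^ 2 + b4 * X 1 ^ 3) -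
    (b0 * X 0 ^ 3 + 3 * b1 * X 0 ^ 2 * X 1 + 3 * b2 * X 0 * X 1 ^ 2 + b3 * X 1 ^ 3) *
    (a1 * X 0 ^ 3 + 3 * a2 * X 0 ^ 2 * X 1 + 3 * a3 * X 0 * X 1 ^ 2 + a4 * X 1 ^ 3)) * h

end Transvectants

section Coefficients
variable {K : Type*} [CommRing K]

/-- The coefficient of `x₁ ^ (n - k) x₂ ^ k` in a form of order `n`. -/
lemma coeff_sum_monomials (n : ℕ) (t : Fin (n + 1) → K) (k : Fin (n + 1)) :
    coeff (Finsupp.single 0 (n - (k : ℕ)) + Finsupp.single 1 (k : ℕ))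
      (∑ k : Fin (n + 1), C (t k) * X 0 ^ (n - (k : ℕ)) * X 1 ^ (k : ℕ) :
        MvPolynomial (Fin 2) K) = t k := by
  rw [coeff_sum, Finset.sum_eq_single k]
  · rw [X_pow_eq_monomial, X_pow_eq_monomial, mul_assoc, monomial_mul, coeff_C_mul, coeff_monomial]
    simp
  · intro l _ hl
    rw [X_pow_eq_monomial, X_pow_eq_monomial, mul_assoc, monomial_mul, coeff_C_mul, coeff_monomial,
      if_neg, mul_zero]
    intro h
    have := DFunLike.congr_fun h 1
    simp at this
    exact hl (Fin.ext this)
  · simp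

lemma coeffIdeal_sum_monomials {d : ℕ} (n : ℕ) (t : Fin (n + 1) → CoeffRing d) :
    coeffIdeal (∑ k : Fin (n + 1), C (t k) * X 0 ^ (n - (k : ℕ)) * X 1 ^ (k : ℕ)) =
      Ideal.span (Set.range t) := by
  apply le_antisymm <;> rw [coeffIdeal, Ideal.span_le]
  · rintro _ ⟨s, rfl⟩
    simp only [coeff_sum, mul_assoc, coeff_C_mul]
    exact Ideal.sum_mem _ fun k _ => Ideal.mul_mem_right _ _ (Ideal.subset_span ⟨k, rfl⟩)
  · rintro _ ⟨k, rfl⟩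
    exact Ideal.subset_span ⟨_, coeff_sum_monomials n t k⟩

lemma binaryForm_injective [IsDomain K] [CharZero K] (d : ℕ) :
    Function.Injective (binaryForm d : (Fin (d + 1) → K) → _) := by
  intro a b h
  ext k
  have := congrArg (coeff (Finsupp.single 0 (d - (k : ℕ)) + Finsupp.single 1 (k : ℕ))) h
  rw [binaryForm, binaryForm, coeff_sum_monomials, coeff_sum_monomials] at this
  exact mul_left_cancel₀ (Nat.cast_ne_zero.mpr
    (Nat.choose_pos (Nat.lt_succ_iff.mp k.2)).ne') this

end Coefficients

/-! ### The discriminant of a quartic -/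

section Discriminant
variable {K : Type*} [CommRing K]

open Polynomial in
/-- The Sylvester matrix of a quartic and its derivative, with its last row divided by the leading
coefficient. -/
lemma sylvesterDeriv_of_natDegree_eq_four {f : K[X]} (hf : f.natDegree = 4) :
    f.sylvesterDeriv.reindex (finCongr <| by rw [hf]) (finCongr <| by rw [hf]) =
    !![f.coeff 0, 0, 0, 1 * f.coeff 1, 0, 0, 0;
       f.coeff 1, f.coeff 0, 0, 2 * f.coeff 2, 1 * f.coeff 1, 0, 0;
       f.coeff 2, f.coeff 1, f.coeff 0, 3 * f.coeff 3, 2 * f.coeff 2, 1 * f.coeff 1, 0;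
       f.coeff 3, f.coeff 2, f.coeff 1, 4 * f.coeff 4, 3 * f.coeff 3, 2 * f.coeff 2, 1 * f.coeff 1;
       f.coeff 4, f.coeff 3, f.coeff 2, 0, 4 * f.coeff 4, 3 * f.coeff 3, 2 * f.coeff 2;
       0, f.coeff 4, f.coeff 3, 0, 0, 4 * f.coeff 4, 3 * f.coeff 3;
       0, 0, 1, 0, 0, 0, 4] := by
  ext ⟨i, hi⟩ ⟨j, hj⟩
  simp only [sylvesterDeriv, hf, OfNat.ofNat_ne_zero, ↓reduceDIte, sylvester, Fin.addCases,
    Nat.add_one_sub_one, Fin.val_castLT, Set.mem_Icc, Fin.val_fin_le, Fin.val_subNat, Fin.val_cast,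
    tsub_le_iff_right, coeff_derivative, eq_rec_constant, dite_eq_ite, Nat.reduceMul, Nat.reduceSub,
    Nat.cast_ofNat, Matrix.reindex_apply, finCongr_symm, Matrix.submatrix_apply, finCongr_apply,
    Fin.cast_mk, Matrix.updateRow_apply, Fin.mk.injEq, Matrix.of_apply, Fin.mk_le_mk, one_mul,
    Matrix.cons_val', Matrix.cons_val_fin_one]
  have hi' : i ∈ Finset.range 7 := Finset.mem_range.mpr hi
  have hj' : j ∈ Finset.range 7 := Finset.mem_range.mpr hj
  fin_cases hi' <;>
  · simp only [Fin.isValue, Fin.mk_one, Fin.reduceFinMk, Fin.zero_eta,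
      Matrix.cons_val_one, Matrix.cons_val_zero, Matrix.cons_val, Nat.reduceAdd, Nat.reduceEqDiff,
      ↓reduceIte]
    fin_cases hj' <;> simp [mul_comm, one_add_one_eq_two, (by norm_num : (2 : K) + 1 = 3),
      (by norm_num : (3 : K) + 1 = 4)]

set_option maxHeartbeats 4000000 in
lemma det_sylvester_quartic (a b c d e : K) :
    !![e, 0, 0, 1 * (4 * d), 0, 0, 0;
       4 * d, e, 0, 2 * (6 * c), 1 * (4 * d), 0, 0;
       6 * c, 4 * d, e, 3 * (4 * b), 2 * (6 * c), 1 * (4 * d), 0;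
       4 * b, 6 * c, 4 * d, 4 * a, 3 * (4 * b), 2 * (6 * c), 1 * (4 * d);
       a, 4 * b, 6 * c, 0, 4 * a, 3 * (4 * b), 2 * (6 * c);
       0, a, 4 * b, 0, 0, 4 * a, 3 * (4 * b);
       0, 0, 1, 0, 0, 0, 4].det =
      256 * ((a * e - 4 * b * d + 3 * c ^ 2) ^ 3 -
        27 * (a * c * e + 2 * b * c * d - c ^ 3 - a * d ^ 2 - b ^ 2 * e) ^ 2) := by
  simp [Matrix.det_succ_row_zero (n := 6), Matrix.det_succ_row_zero (n := 5),
    Matrix.det_succ_row_zero (n := 4), Matrix.det_succ_row_zero (n := 3), Fin.succAbove,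
    Matrix.det_fin_three, Finset.sum_fin_eq_sum_range, Finset.sum_range_succ]
  ring

/-- The discriminant of the dehomogenised quartic, written through its classical invariants. -/
lemma discr_binaryForm_four [Nontrivial K] (a : Fin 5 → K) (h0 : a 0 ≠ 0) :
    (aeval ![(Polynomial.X : Polynomial K), 1] (binaryForm 4 a)).discr =
      256 * ((a 0 * a 4 - 4 * a 1 * a 3 + 3 * a 2 ^ 2) ^ 3 -
        27 * (a 0 * a 2 * a 4 + 2 * a 1 * a 2 * a 3 - a 2 ^ 3 - a 0 * a 3 ^ 2 -
          a 1 ^ 2 * a 4) ^ 2) := by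
  have hf : aeval ![(Polynomial.X : Polynomial K), 1] (binaryForm 4 a) =
      Polynomial.C (a 0) * Polynomial.X ^ 4 + Polynomial.C (4 * a 1) * Polynomial.X ^ 3 +
      Polynomial.C (6 * a 2) * Polynomial.X ^ 2 + Polynomial.C (4 * a 3) * Polynomial.X +
      Polynomial.C (a 4) := by
    rw [binaryForm_four]
    simp [Polynomial.algebraMap_eq, Polynomial.C_mul, map_ofNat]
  have hn : (Polynomial.C (a 0) * Polynomial.X ^ 4 + Polynomial.C (4 * a 1) * Polynomial.X ^ 3 +
      Polynomial.C (6 * a 2) * Polynomial.X ^ 2 + Polynomial.C (4 * a 3) * Polynomial.X +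
      Polynomial.C (a 4)).natDegree = 4 := by
    compute_degree!
  have hc : ∀ n, (Polynomial.C (a 0) * Polynomial.X ^ 4 +
      Polynomial.C (4 * a 1) * Polynomial.X ^ 3 + Polynomial.C (6 * a 2) * Polynomial.X ^ 2 +
      Polynomial.C (4 * a 3) * Polynomial.X + Polynomial.C (a 4)).coeff n =
        (if n = 4 then a 0 else 0) + (if n = 3 then 4 * a 1 else 0) +
        (if n = 2 then 6 * a 2 else 0) + (if n = 1 then 4 * a 3 else 0) +
        (if n = 0 then a 4 else 0) := by
    intro n
    simp only [Polynomial.coeff_add, Polynomial.coeff_C_mul_X_pow, Polynomial.coeff_C_mul_X,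
      Polynomial.coeff_C]
  rw [hf, Polynomial.discr, ← Matrix.det_reindex_self (finCongr (by rw [hn]) : _ ≃ Fin 7),
    sylvesterDeriv_of_natDegree_eq_four hn]
  simp only [hc, hn]
  norm_num only [if_true, if_false, zero_add, add_zero]
  have := det_sylvester_quartic (a 0) (a 1) (a 2) (a 3) (a 4)
  simp only [one_mul, mul_one] at this ⊢
  exact this

end Discriminant

/-! ### The covariants of the generic quartic -/

section Formulas

lemma C_ofNat' (n : ℕ) [n.AtLeastTwo] : (C (ofNat(n) : ℂ) : CoeffRing 4) = ofNat(n) :=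
  map_ofNat C n

lemma invI_eq : invI = 2 * (X 0 * X 4 - 4 * X 1 * X 3 + 3 * X 2 ^ 2) := by
  rw [invI, genericForm, transvectant_four_four_four, constantCoeff_C]
  ring

/-- The coefficients `h₀, …, h₄` of the Hessian `∑ (4 choose k) h_k x₁^(4-k) x₂^k` of the generic
quartic. -/
def hessianCoeff : Fin 5 → CoeffRing 4 :=
  ![2 * (X 0 * X 2 - X 1 ^ 2), X 0 * X 3 - X 1 * X 2,
    C (1 / 3) * (X 0 * X 4 + 2 * X 1 * X 3 - 3 * X 2 ^ 2),
    X 1 * X 4 - X 2 * X 3, 2 * (X 2 * X 4 - X 3 ^ 2)]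

lemma hessian_eq : hessian 4 = binaryForm 4 hessianCoeff := by
  rw [hessian, genericForm, transvectant_four_four_two]
  have h : algebraMap ℚ (CoeffRing 4) (1 / 3) = C (1 / 3) := by
    rw [IsScalarTower.algebraMap_apply ℚ ℂ (CoeffRing 4), algebraMap_eq]
    norm_num
  rw [h]
  rfl

lemma C_third_mul_three : (C (1 / 3) : CoeffRing 4) * 3 = 1 := by
  rw [show (3 : CoeffRing 4) = C 3 from (map_ofNat C 3).symm, ← C_mul]
  norm_num

lemma invJ_eq : invJ = 6 * (X 0 * X 2 * X 4 + 2 * X 1 * X 2 * X 3 - X 2 ^ 3 - X 0 * X 3 ^ 2 -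
    X 1 ^ 2 * X 4) := by
  rw [invJ, hessian_eq, genericForm, transvectant_four_four_four, constantCoeff_C]
  have h := C_third_mul_three
  simp only [hessianCoeff, Matrix.cons_val]
  linear_combination 2 * X 2 * (X 0 * X 4 + 2 * X 1 * X 3 - 3 * X 2 ^ 2) * h

lemma discriminant_eq : discriminant 4 = C 32 * (invI ^ 3 - 6 * invJ ^ 2) := by
  rw [discriminant, genericForm, discr_binaryForm_four _ (X_ne_zero _), invI_eq, invJ_eq,
    show (C 32 : CoeffRing 4) = 32 from map_ofNat C 32]
  ring

/-- The coefficients of `i² F - 6 j H`. -/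
def evectantCoeff (k : Fin 5) : CoeffRing 4 := invI ^ 2 * X k - 6 * invJ * hessianCoeff k

/-- The partial derivatives of `i³ - 6 j²` are, up to nonzero scalars and the order, the
coefficients of `i² F - 6 j H`. -/
lemma pderiv_invI_pow_three_sub (k : Fin 5) :
    pderiv k (invI ^ 3 - 6 * invJ ^ 2) =
      6 * (-1) ^ (k : ℕ) * (Nat.choose 4 k : CoeffRing 4) * evectantCoeff k.rev := by
  have h := C_third_mul_three
  have hc : ∀ (f : CoeffRing 4), pderiv k (6 * f) = 6 * pderiv k f := fun f => by
    rw [show (6 : CoeffRing 4) = C 6 from (map_ofNat C 6).symm, pderiv_C_mul]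
  have h2 : ∀ (f : CoeffRing 4), pderiv k (2 * f) = 2 * pderiv k f := fun f => by
    rw [show (2 : CoeffRing 4) = C 2 from (map_ofNat C 2).symm, pderiv_C_mul]
  have h3 : ∀ (f : CoeffRing 4), pderiv k (3 * f) = 3 * pderiv k f := fun f => by
    rw [show (3 : CoeffRing 4) = C 3 from (map_ofNat C 3).symm, pderiv_C_mul]
  have h4 : ∀ (f : CoeffRing 4), pderiv k (4 * f) = 4 * pderiv k f := fun f => by
    rw [show (4 : CoeffRing 4) = C 4 from (map_ofNat C 4).symm, pderiv_C_mul]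
  simp only [evectantCoeff, map_sub, hc, Derivation.leibniz_pow]
  have hI : pderiv k invI = 2 * (-1) ^ (k : ℕ) * (Nat.choose 4 k : CoeffRing 4) * X k.rev := by
    rw [invI_eq]
    simp only [map_sub, map_add, h2, h3, h4, Derivation.leibniz, Derivation.leibniz_pow, pderiv_X,
      mul_assoc]
    fin_cases k <;> simp [Fin.rev, Nat.choose] <;> ring
  have hJ : pderiv k invJ =
      3 * (-1) ^ (k : ℕ) * (Nat.choose 4 k : CoeffRing 4) * hessianCoeff k.rev := by
    rw [invJ_eq]
    simp only [map_sub, map_add, h2, hc, Derivation.leibniz, Derivation.leibniz_pow,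
      pderiv_X, mul_assoc]
    fin_cases k <;> simp [Fin.rev, Nat.choose, hessianCoeff]
    · ring
    · ring
    · rw [one_div] at h
      linear_combination -6 * (X 0 * X 4 + 2 * (X 1 * X 3) - 3 * X 2 ^ 2) * h
    · ring
    · ring
  rw [hI, hJ]
  simp
  ring

lemma neg_one_pow_mul_self {A : Type*} [CommRing A] (k : ℕ) : (-1 : A) ^ k * (-1) ^ k = 1 := by
  rw [← mul_pow]; simp

lemma evectant_eq : evectant 4 6 (invI ^ 3 - 6 * invJ ^ 2) =
    C (invI ^ 2) * genericForm 4 - 6 * C invJ * hessian 4 := by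
  have h6 : (C (C ((-1) ^ 4 / ((6 : ℕ) : ℂ))) : MvPolynomial (Fin 2) (CoeffRing 4)) * 6 = 1 := by
    rw [show (6 : MvPolynomial (Fin 2) (CoeffRing 4)) = C (C 6) by simp [map_ofNat], ← C_mul,
      ← C_mul]
    norm_num
  rw [evectant, hessian_eq, genericForm]
  have hk : ∀ k : Fin 5, (C (pderiv k (invI ^ 3 - 6 * invJ ^ 2)) :
      MvPolynomial (Fin 2) (CoeffRing 4)) * X 1 ^ (4 - (k : ℕ)) * (-X 0) ^ (k : ℕ) =
      6 * (((Nat.choose 4 k : ℕ) : MvPolynomial (Fin 2) (CoeffRing 4)) *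
        C (evectantCoeff k.rev) * X 1 ^ (4 - (k : ℕ)) * X 0 ^ (k : ℕ)) := by
    intro k
    rw [pderiv_invI_pow_three_sub, neg_pow (X 0 : MvPolynomial (Fin 2) (CoeffRing 4))]
    have h1 : ((-1) ^ (k : ℕ) * (-1) ^ (k : ℕ) : MvPolynomial (Fin 2) (CoeffRing 4)) = 1 :=
      neg_one_pow_mul_self k
    simp only [C_mul, C_pow, C_neg, C_1, map_natCast, C_ofNat]
    linear_combination (6 * ((Nat.choose 4 k : ℕ) * C (evectantCoeff k.rev) * X 1 ^ (4 - (k : ℕ)) *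
      X 0 ^ (k : ℕ))) * h1
  have hs := Finset.sum_congr (rfl : (Finset.univ : Finset (Fin 5)) = Finset.univ)
    fun k _ => hk k
  refine (congrArg (C (C ((-1) ^ 4 / ((6 : ℕ) : ℂ))) * ·) hs).trans ?_
  rw [← Finset.mul_sum, ← mul_assoc, h6, one_mul, Fin.sum_univ_five, binaryForm_four,
    binaryForm_four]
  simp [Fin.rev, Nat.choose, evectantCoeff, C_ofNat]
  ring

/-- The coefficients of the cubicovariant of the generic quartic. -/
def cubicovariantCoeff : Fin 7 → CoeffRing 4 :=
  ![X 0 ^ 2 * X 3 - 3 * X 0 * X 1 * X 2 + 2 * X 1 ^ 3,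
    X 0 ^ 2 * X 4 + 2 * X 0 * X 1 * X 3 - 9 * X 0 * X 2 ^ 2 + 6 * X 1 ^ 2 * X 2,
    5 * (X 0 * X 1 * X 4 - 3 * X 0 * X 2 * X 3 + 2 * X 1 ^ 2 * X 3),
    10 * (X 1 ^ 2 * X 4 - X 0 * X 3 ^ 2),
    -5 * (X 0 * X 3 * X 4 - 3 * X 1 * X 2 * X 4 + 2 * X 1 * X 3 ^ 2),
    -(X 0 * X 4 ^ 2 + 2 * X 1 * X 3 * X 4 - 9 * X 2 ^ 2 * X 4 + 6 * X 2 * X 3 ^ 2),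
    -(X 1 * X 4 ^ 2 - 3 * X 2 * X 3 * X 4 + 2 * X 3 ^ 3)]

lemma firstTransvectantCoeff_mem {I : Ideal (CoeffRing 4)} {b : Fin 5 → CoeffRing 4}
    (hb : ∀ l, b l ∈ I) (k : Fin 7) : firstTransvectantCoeff X b k ∈ I := by
  have h : ∀ l, Ideal.Quotient.mk I (b l) = 0 := fun l => Ideal.Quotient.eq_zero_iff_mem.mpr (hb l)
  rw [← Ideal.Quotient.eq_zero_iff_mem]
  fin_cases k <;> simp [firstTransvectantCoeff, h]

lemma firstTransvectantCoeff_hessianCoeff :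
    firstTransvectantCoeff X hessianCoeff = cubicovariantCoeff := by
  have h := C_third_mul_three
  ext1 k
  fin_cases k <;> simp [firstTransvectantCoeff, hessianCoeff, cubicovariantCoeff, -one_div]
  · ring
  · linear_combination X 0 * (X 0 * X 4 + 2 * X 1 * X 3 - 3 * X 2 ^ 2) * h
  · linear_combination 2 * X 1 * (X 0 * X 4 + 2 * X 1 * X 3 - 3 * X 2 ^ 2) * h
  · ring
  · linear_combination -2 * X 3 * (X 0 * X 4 + 2 * X 1 * X 3 - 3 * X 2 ^ 2) * h
  · linear_combination -X 4 * (X 0 * X 4 + 2 * X 1 * X 3 - 3 * X 2 ^ 2) * h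
  · ring

lemma coeffIdeal_cubicovariant :
    coeffIdeal (cubicovariant 4) = Ideal.span (Set.range cubicovariantCoeff) := by
  rw [← firstTransvectantCoeff_hessianCoeff, ← coeffIdeal_sum_monomials, cubicovariant,
    hessian_eq, genericForm]
  exact congrArg coeffIdeal (transvectant_four_four_one X hessianCoeff)

/-- Since `(F, F)₁ = 0`, the first transvectant of `F` with `i² F - 6 j H` is `-6 j T`. -/
lemma firstTransvectantCoeff_evectantCoeff (k : Fin 7) :
    firstTransvectantCoeff X evectantCoeff k = -6 * invJ * cubicovariantCoeff k := by
  rw [← firstTransvectantCoeff_hessianCoeff]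
  fin_cases k <;> simp [firstTransvectantCoeff, evectantCoeff] <;> ring

lemma jacobianIdeal_discriminant :
    jacobianIdeal (discriminant 4) = Ideal.span (Set.range evectantCoeff) := by
  have hu : ∀ k : Fin 5, ∃ c : ℂ, c ≠ 0 ∧
      pderiv k (discriminant 4) = C c * evectantCoeff k.rev := by
    intro k
    have hk : ((Nat.choose 4 k : ℕ) : ℂ) ≠ 0 :=
      Nat.cast_ne_zero.mpr (Nat.choose_pos (Nat.lt_succ_iff.mp k.2)).ne'
    refine ⟨32 * (6 * (-1) ^ (k : ℕ) * (Nat.choose 4 k : ℕ)), ?_, ?_⟩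
    · simp [hk]
    · rw [discriminant_eq, pderiv_C_mul, pderiv_invI_pow_three_sub]
      simp only [C_mul, C_pow, C_neg, C_1, map_natCast, C_ofNat']
      ring
  apply le_antisymm <;> rw [jacobianIdeal, Ideal.span_le]
  · rintro _ ⟨k, rfl⟩
    obtain ⟨c, -, h⟩ := hu k
    simp only [h]
    exact Ideal.mul_mem_left _ _ (Ideal.subset_span ⟨_, rfl⟩)
  · rintro _ ⟨k, rfl⟩
    obtain ⟨c, hc, h⟩ := hu k.rev
    have : evectantCoeff k = C c⁻¹ * pderiv k.rev (discriminant 4) := by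
      rw [h, ← mul_assoc, ← C_mul, inv_mul_cancel₀ hc, C_1, one_mul, Fin.rev_rev]
    rw [this]
    exact Ideal.mul_mem_left _ _ (Ideal.subset_span ⟨_, rfl⟩)

/-- The coefficients of `-6 j T = (F, i² F - 6 j H)₁` are combinations of the coefficients of
`i² F - 6 j H`, which generate the Jacobian ideal. -/
lemma invJ_mul_mem_jacobianIdeal {t : CoeffRing 4} (ht : t ∈ coeffIdeal (cubicovariant 4)) :
    invJ * t ∈ jacobianIdeal (discriminant 4) := by
  rw [jacobianIdeal_discriminant]
  rw [coeffIdeal_cubicovariant] at ht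
  refine Submodule.span_induction (p := fun t _ => invJ * t ∈ _) ?_ (by simp) ?_ ?_ ht
  · rintro _ ⟨k, rfl⟩
    have hg : ∀ l, evectantCoeff l ∈ Ideal.span (Set.range evectantCoeff) := fun l =>
      Ideal.subset_span ⟨l, rfl⟩
    have h6 : (C (-1 / 6) : CoeffRing 4) * -6 = 1 := by
      rw [show (-6 : CoeffRing 4) = C (-6) by rw [C_neg, C_ofNat'], ← C_mul]
      norm_num
    have : invJ * cubicovariantCoeff k = C (-1 / 6) * firstTransvectantCoeff X evectantCoeff k := by
      rw [firstTransvectantCoeff_evectantCoeff]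
      linear_combination (-invJ * cubicovariantCoeff k) * h6
    rw [this]
    exact Ideal.mul_mem_left _ _ (firstTransvectantCoeff_mem hg k)
  · intro x y _ _ hx hy
    rw [mul_add]
    exact add_mem hx hy
  · intro c x _ hx
    rw [smul_eq_mul, mul_left_comm]
    exact Ideal.mul_mem_left _ _ hx

end Formulas

/-! ### Irreducibility of the invariant `i` -/

lemma eq_zero_of_eval_eq_zero_of_ne {n : ℕ} {p g : MvPolynomial (Fin n) ℂ} (hg : g ≠ 0)
    (h : ∀ y, eval y g ≠ 0 → eval y p = 0) : p = 0 := by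
  have : g * p = 0 := funext fun y => by
    by_cases hy : eval y g = 0
    · simp [hy]
    · simp [h y hy]
  exact (mul_eq_zero.mp this).resolve_left hg

lemma isHomogeneous_one_fin_two {l : MvPolynomial (Fin 2) ℂ} (h : l.IsHomogeneous 1) :
    ∃ s t : ℂ, l = C s * X 0 + C t * X 1 := by
  refine ⟨coeff (Finsupp.single 0 1) l, coeff (Finsupp.single 1 1) l, ?_⟩
  ext d
  by_cases hd : d.degree = 1
  · have h01 : d 0 + d 1 = 1 := by
      rw [Finsupp.degree_eq_sum, Fin.sum_univ_two] at hd; exact hd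
    have : d = Finsupp.single 0 1 ∨ d = Finsupp.single 1 1 := by
      rcases Nat.eq_zero_or_pos (d 0) with h0 | h0
      · right; ext i; fin_cases i
        · simpa using h0
        · simp; omega
      · left; ext i; fin_cases i
        · simp; omega
        · simp; omega
    rcases this with rfl | rfl <;> simp [coeff_C_mul, coeff_X, Finsupp.single_left_inj]
  · rw [h.coeff_eq_zero hd, (IsHomogeneous.coeff_eq_zero (n := 1) _ hd)]
    exact ((isHomogeneous_X ℂ 0).C_mul _).add ((isHomogeneous_X ℂ 1).C_mul _)

lemma sub_algHom_mem_of_forall_X {σ R : Type*} [CommRing R]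
    {θ : MvPolynomial σ R →ₐ[R] MvPolynomial σ R} {I : Ideal (MvPolynomial σ R)}
    (h : ∀ k, X k - θ (X k) ∈ I) (f : MvPolynomial σ R) : f - θ f ∈ I := by
  have hc : (Ideal.Quotient.mkₐ R I).comp θ = Ideal.Quotient.mkₐ R I := by
    ext k
    exact (Ideal.Quotient.eq.mpr (h k)).symm
  exact Ideal.Quotient.eq.mp (AlgHom.congr_fun hc f).symm

section Irreducible

lemma irreducible_C_mul_X {n : ℕ} {c : ℂ} (hc : c ≠ 0) (i : Fin n) :
    Irreducible (C c * X i : MvPolynomial (Fin n) ℂ) := by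
  have hu : IsUnit (C c : MvPolynomial (Fin n) ℂ) := (IsUnit.mk0 c hc).map C
  exact (irreducible_isUnit_mul hu).mpr (X_prime (R := ℂ) (i := i)).irreducible

lemma notMem_vars_of_mem_supported {n : ℕ} {p : MvPolynomial (Fin n) ℂ} {i : Fin n}
    (h : p ∈ supported ℂ ({i}ᶜ : Set (Fin n))) : i ∉ p.vars := fun hi =>
  mem_supported.mp h hi rfl

/-- The invariant `i` is linear in `a₄`, with leading coefficient `2 a₀` prime to the rest. -/
lemma prime_invI : Prime invI := by
  have h : invI = C 2 * X 0 * X 4 + (C 6 * X 2 ^ 2 - C 8 * X 1 * X 3) := by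
    rw [invI_eq]; simp only [C_ofNat']; ring
  rw [h]
  apply Irreducible.prime
  have hX : ∀ i : Fin 5, i ≠ 4 → (X i : CoeffRing 4) ∈ supported ℂ ({4}ᶜ : Set (Fin 5)) :=
    fun i hi => X_mem_supported.mpr hi
  have hC : ∀ c : ℂ, (C c : CoeffRing 4) ∈ supported ℂ ({4}ᶜ : Set (Fin 5)) :=
    fun c => Subalgebra.algebraMap_mem _ c
  apply irreducible_mul_X_add
  · exact (irreducible_C_mul_X two_ne_zero 0).ne_zero
  · exact notMem_vars_of_mem_supported (mul_mem (hC _) (hX _ (by decide)))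
  · exact notMem_vars_of_mem_supported (sub_mem (mul_mem (hC _) (pow_mem (hX _ (by decide)) _))
      (mul_mem (mul_mem (hC _) (hX _ (by decide))) (hX _ (by decide))))
  · rw [(irreducible_C_mul_X two_ne_zero 0).isRelPrime_iff_not_dvd]
    rintro ⟨q, hq⟩
    have := congrArg (eval ![0, 0, 1, 0, 0]) hq
    simp at this

/-- Setting `a₀ = 0`. -/
def setFirstZero : CoeffRing 4 →ₐ[ℂ] CoeffRing 4 := aeval ![0, X 1, X 2, X 3, X 4]

lemma setFirstZero_X (k : Fin 5) : setFirstZero (X k) = ![0, X 1, X 2, X 3, X 4] k :=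
  aeval_X _ _

lemma X_zero_dvd_sub_setFirstZero (f : CoeffRing 4) : X 0 ∣ f - setFirstZero f := by
  rw [← Ideal.mem_span_singleton]
  refine sub_algHom_mem_of_forall_X (fun k => ?_) f
  rw [Ideal.mem_span_singleton, setFirstZero_X]
  fin_cases k <;> simp

lemma prime_setFirstZero_invI : Prime (setFirstZero invI) := by
  have h : setFirstZero invI = C (-8) * X 1 * X 3 + C 6 * X 2 ^ 2 := by
    rw [invI_eq]
    simp only [map_mul, map_add, map_sub, map_pow, map_ofNat, setFirstZero_X, Matrix.cons_val,
      C_neg]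
    ring
  rw [h]
  apply Irreducible.prime
  have hX : ∀ i : Fin 5, i ≠ 3 → (X i : CoeffRing 4) ∈ supported ℂ ({3}ᶜ : Set (Fin 5)) :=
    fun i hi => X_mem_supported.mpr hi
  have hC : ∀ c : ℂ, (C c : CoeffRing 4) ∈ supported ℂ ({3}ᶜ : Set (Fin 5)) :=
    fun c => Subalgebra.algebraMap_mem _ c
  have h8 : (-8 : ℂ) ≠ 0 := by norm_num
  apply irreducible_mul_X_add
  · exact (irreducible_C_mul_X h8 1).ne_zero
  · exact notMem_vars_of_mem_supported (mul_mem (hC _) (hX _ (by decide)))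
  · exact notMem_vars_of_mem_supported (mul_mem (hC _) (pow_mem (hX _ (by decide)) _))
  · rw [(irreducible_C_mul_X h8 1).isRelPrime_iff_not_dvd]
    rintro ⟨q, hq⟩
    have := congrArg (eval ![0, 0, 1, 0, 0]) hq
    simp at this

lemma not_invI_dvd_invJ : ¬ invI ∣ invJ := by
  rintro ⟨q, hq⟩
  have := congrArg (eval ![0, 1, 0, 0, 1]) hq
  rw [invI_eq, invJ_eq] at this
  simp at this

lemma not_setFirstZero_invI_dvd_invJ : ¬ setFirstZero invI ∣ setFirstZero invJ := by
  rintro ⟨q, hq⟩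
  have := congrArg (eval ![0, 1, 0, 0, 1]) hq
  rw [invI_eq, invJ_eq] at this
  simp only [map_mul, map_add, map_sub, map_pow, map_ofNat, setFirstZero_X, Matrix.cons_val,
    eval_X] at this
  simp at this

/-- The sequence `a₀, i, j` is regular, and `a₀` remains regular modulo `(i, j)`: if
`a₀ f = p i + q j`, then modulo `a₀` the pair `(p, q)` is a multiple of `(-j, i)`. -/
lemma mem_span_pair_of_X_zero_mul_mem {f : CoeffRing 4}
    (h : X 0 * f ∈ Ideal.span {invI, invJ}) : f ∈ Ideal.span {invI, invJ} := by
  obtain ⟨p, q, hpq⟩ := Ideal.mem_span_pair.mp h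
  have h0 := congrArg setFirstZero hpq
  have hX : setFirstZero (X 0 : CoeffRing 4) = 0 := by simp [setFirstZero]
  rw [map_add, map_mul, map_mul, map_mul, hX, zero_mul] at h0
  have hd : setFirstZero invI ∣ setFirstZero q * setFirstZero invJ :=
    ⟨-setFirstZero p, by linear_combination h0⟩
  obtain ⟨s, hs⟩ := (prime_setFirstZero_invI.dvd_or_dvd hd).resolve_right
    not_setFirstZero_invI_dvd_invJ
  have hp : setFirstZero p = -s * setFirstZero invJ := by
    apply mul_right_cancel₀ prime_setFirstZero_invI.ne_zero
    rw [hs] at h0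
    linear_combination h0
  obtain ⟨p', hp'⟩ := X_zero_dvd_sub_setFirstZero p
  obtain ⟨q', hq'⟩ := X_zero_dvd_sub_setFirstZero q
  obtain ⟨i', hi'⟩ := X_zero_dvd_sub_setFirstZero invI
  obtain ⟨j', hj'⟩ := X_zero_dvd_sub_setFirstZero invJ
  refine Ideal.mem_span_pair.mpr ⟨p' + s * j', q' - s * i', ?_⟩
  apply mul_left_cancel₀ (X_ne_zero (R := ℂ) (0 : Fin 5))
  linear_combination hpq - invI * hp' - invJ * hq' - invI * hp - invJ * hs -
    s * invI * hj' + s * invJ * hi'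

lemma mem_span_pair_of_X_zero_pow_mul_mem {f : CoeffRing 4} (N : ℕ)
    (h : X 0 ^ N * f ∈ Ideal.span {invI, invJ}) : f ∈ Ideal.span {invI, invJ} := by
  induction N with
  | zero => simpa using h
  | succ N ih =>
    rw [pow_succ', mul_assoc] at h
    exact ih (mem_span_pair_of_X_zero_mul_mem h)

end Irreducible

/-! ### Quartics with a triple root -/

section ProjectiveIdeal

lemma mem_projectiveIdeal_of_isHomogeneous {d m : ℕ}
    {S : Set (Projectivization ℂ (Fin (d + 1) → ℂ))} {f : CoeffRing d} (hf : f.IsHomogeneous m)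
    (h : ∀ (v : Fin (d + 1) → ℂ) (hv : v ≠ 0), Projectivization.mk ℂ v hv ∈ S → eval v f = 0) :
    f ∈ projectiveIdeal S :=
  Ideal.subset_span ⟨⟨m, hf⟩, h⟩

/-- A representative of a point of a coincident root locus is a product of powers of linear forms
up to a scalar. -/
lemma exists_binaryForm_eq_of_mem_coincidentRootLocus {d n : ℕ} {lam : Fin n → ℕ}
    {v : Fin (d + 1) → ℂ} {hv : v ≠ 0}
    (h : Projectivization.mk ℂ v hv ∈ coincidentRootLocus d lam) :
    ∃ (c : ℂ) (l : Fin n → MvPolynomial (Fin 2) ℂ), (∀ k, (l k).IsHomogeneous 1) ∧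
      binaryForm d v = C c * ∏ k, l k ^ lam k := by
  obtain ⟨w, hw, hwv, l, hl, hp⟩ := h
  obtain ⟨c, hc⟩ := (Projectivization.mk_eq_mk_iff' ℂ v w hv hw).mp hwv.symm
  refine ⟨c, l, hl, ?_⟩
  rw [← hc, ← hp, binaryForm, binaryForm, Finset.mul_sum]
  refine Finset.sum_congr rfl fun k _ => ?_
  simp only [Pi.smul_apply, smul_eq_mul, C_mul]
  ring

end ProjectiveIdeal

section TangentDevelopable

/-- The leading coefficient `a₀ a₂ - a₁²` of the Hessian (halved). -/
def hessianLead : CoeffRing 4 := X 0 * X 2 - X 1 ^ 2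

/-- The leading coefficient of the cubicovariant. -/
def cubicovariantLead : CoeffRing 4 := X 0 ^ 2 * X 3 - 3 * X 0 * X 1 * X 2 + 2 * X 1 ^ 3

lemma C_half_mul_two : (C (1 / 2) : CoeffRing 4) * 2 = 1 := by
  rw [← C_ofNat', ← C_mul]
  norm_num

/-- The classical syzygy `G² + 4 H³ ≡ 0` between the leading coefficients of the covariants. -/
lemma syzygy_mem :
    cubicovariantLead ^ 2 + 4 * hessianLead ^ 3 ∈ Ideal.span {invI, invJ} := by
  have h2 := C_half_mul_two
  have h6 : (C (1 / 6) : CoeffRing 4) * 6 = 1 := by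
    rw [← C_ofNat', ← C_mul]
    norm_num
  refine Ideal.mem_span_pair.mpr
    ⟨C (1 / 2) * X 0 ^ 2 * hessianLead, -C (1 / 6) * X 0 ^ 3, ?_⟩
  rw [invI_eq, invJ_eq, hessianLead, cubicovariantLead]
  linear_combination X 0 ^ 2 * (X 0 * X 2 - X 1 ^ 2) *
    (X 0 * X 4 - 4 * X 1 * X 3 + 3 * X 2 ^ 2) * h2 - X 0 ^ 3 * (X 0 * X 2 * X 4 +
      2 * X 1 * X 2 * X 3 - X 2 ^ 3 - X 0 * X 3 ^ 2 - X 1 ^ 2 * X 4) * h6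

/-- The substitution of the seminvariants `a₀, a₁, a₀ a₂ - a₁²`. -/
def seminvariantSubst : MvPolynomial (Fin 3) ℂ →ₐ[ℂ] CoeffRing 4 :=
  aeval ![X 0, X 1, hessianLead]

lemma seminvariantSubst_X (k : Fin 3) :
    seminvariantSubst (X k) = ![X 0, X 1, hessianLead] k := aeval_X _ _

/-- Normal forms `p + q G`, up to powers of `x`, are closed under multiplication. -/
lemma eliminate_mul {A : Type*} [CommRing A] {I : Ideal A} {x f g p q p' q' G H : A} {N M : ℕ}
    (hG : G ^ 2 + 4 * H ^ 3 ∈ I) (hf : x ^ N * f - (p + q * G) ∈ I)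
    (hg : x ^ M * g - (p' + q' * G) ∈ I) :
    x ^ (N + M) * (f * g) - ((p * p' - 4 * H ^ 3 * (q * q')) + (p * q' + q * p') * G) ∈ I := by
  have : x ^ (N + M) * (f * g) - ((p * p' - 4 * H ^ 3 * (q * q')) + (p * q' + q * p') * G) =
      x ^ N * f * (x ^ M * g - (p' + q' * G)) + (p' + q' * G) * (x ^ N * f - (p + q * G)) +
        q * q' * (G ^ 2 + 4 * H ^ 3) := by
    rw [pow_add]; ring
  rw [this]
  exact add_mem (add_mem (I.mul_mem_left _ hg) (I.mul_mem_left _ hf)) (I.mul_mem_left _ hG)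

/-- Modulo `(i, j)` and up to a power of `a₀`, every polynomial is a polynomial in the
seminvariants, of degree at most one in the last one. -/
lemma exists_seminvariantSubst (f : CoeffRing 4) :
    ∃ (N : ℕ) (p q : MvPolynomial (Fin 3) ℂ), X 0 ^ N * f - (seminvariantSubst p +
      seminvariantSubst q * cubicovariantLead) ∈ Ideal.span {invI, invJ} := by
  induction f using MvPolynomial.induction_on with
  | C c =>
    refine ⟨0, C c, 0, ?_⟩
    simp [seminvariantSubst, algebraMap_eq]
  | add f g hf hg =>
    obtain ⟨N, p, q, hf⟩ := hf
    obtain ⟨M, p', q', hg⟩ := hg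
    refine ⟨N + M, X 0 ^ M * p + X 0 ^ N * p', X 0 ^ M * q + X 0 ^ N * q', ?_⟩
    simp only [map_add, map_mul, map_pow, seminvariantSubst_X, Matrix.cons_val]
    convert add_mem (Ideal.mul_mem_left _ (X 0 ^ M) hf) (Ideal.mul_mem_left _ (X 0 ^ N) hg) using 1
    rw [pow_add]
    ring
  | mul_X f k hf =>
    obtain ⟨N, p, q, hf⟩ := hf
    have hk : ∃ (M : ℕ) (p q : MvPolynomial (Fin 3) ℂ), X 0 ^ M * X k - (seminvariantSubst p +
        seminvariantSubst q * cubicovariantLead) ∈ Ideal.span {invI, invJ} := by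
      fin_cases k
      · refine ⟨0, X 0, 0, ?_⟩
        simp [seminvariantSubst_X]
      · refine ⟨0, X 1, 0, ?_⟩
        simp [seminvariantSubst_X]
      · refine ⟨1, X 2 + X 1 ^ 2, 0, ?_⟩
        simp [seminvariantSubst_X, hessianLead]
      · refine ⟨2, 3 * X 1 * X 2 + X 1 ^ 3, 1, ?_⟩
        simp only [map_add, map_mul, map_pow, map_ofNat, map_one, seminvariantSubst_X,
          Matrix.cons_val]
        convert Ideal.zero_mem _ using 1
        simp [hessianLead, cubicovariantLead]
        ring
      · refine ⟨3, 6 * X 1 ^ 2 * X 2 + X 1 ^ 4 - 3 * X 2 ^ 2, 4 * X 1, ?_⟩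
        simp only [map_add, map_sub, map_mul, map_pow, map_ofNat, seminvariantSubst_X,
          Matrix.cons_val]
        refine Ideal.mem_span_pair.mpr ⟨C (1 / 2) * X 0 ^ 2, 0, ?_⟩
        rw [invI_eq]
        simp only [hessianLead, cubicovariantLead]
        dsimp
        linear_combination X 0 ^ 2 * (X 0 * X 4 - 4 * X 1 * X 3 + 3 * X 2 ^ 2) * C_half_mul_two
    obtain ⟨M, p', q', hk⟩ := hk
    refine ⟨N + M, p * p' - 4 * X 2 ^ 3 * (q * q'), p * q' + q * p', ?_⟩
    simp only [map_add, map_sub, map_mul, map_pow, map_ofNat, seminvariantSubst_X, Matrix.cons_val]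
    exact eliminate_mul syzygy_mem hf hk

/-- A parametrisation of the quartics `c (x₁ + t x₂)⁴ + 4 c m x₂ (x₁ + t x₂)³`, in the
variables `c, t, m`. These are the quartics with a triple root and with `a₀ ≠ 0`. -/
def tangentParam {A : Type*} [CommRing A] (c t m : A) : Fin 5 → A :=
  ![c, c * (t + m), c * (t ^ 2 + 2 * t * m), c * (t ^ 3 + 3 * t ^ 2 * m),
    c * (t ^ 4 + 4 * t ^ 3 * m)]

/-- The pullback of polynomials under the parametrisation of quartics with a triple root. -/
def tangentPullback : CoeffRing 4 →ₐ[ℂ] MvPolynomial (Fin 3) ℂ :=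
  aeval (tangentParam (X 0) (X 1) (X 2))

lemma eval_tangentPullback (y : Fin 3 → ℂ) (f : CoeffRing 4) :
    eval y (tangentPullback f) = eval (tangentParam (y 0) (y 1) (y 2)) f := by
  rw [tangentPullback, ← coe_aeval_eq_eval, RingHom.coe_coe, ← AlgHom.comp_apply, comp_aeval,
    ← coe_aeval_eq_eval, RingHom.coe_coe]
  congr 2
  ext k
  fin_cases k <;> simp [tangentParam]

lemma exists_sq_eq (z : ℂ) : ∃ k : ℂ, k ^ 2 = z := by
  obtain ⟨k, hk⟩ := IsAlgClosed.exists_pow_nat_eq z (n := 2) (by norm_num)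
  exact ⟨k, hk⟩

/-- On the quartics with a triple root the seminvariants `c, b, h` are independent, and the last
one, `g` with `g² = -4 h³`, is not rational in them; so `p + q g` vanishes only for `p = q = 0`. -/
lemma eq_zero_of_tangentPullback {p q : MvPolynomial (Fin 3) ℂ}
    (h : tangentPullback (seminvariantSubst p + seminvariantSubst q * cubicovariantLead) = 0) :
    p = 0 ∧ q = 0 := by
  have key : ∀ c b k : ℂ, c ≠ 0 →
      eval ![c, b, -k ^ 2] p + eval ![c, b, -k ^ 2] q * (2 * k ^ 3) = 0 := by
    intro c b k hc
    -- At this point of the parameter space `a₀ = c`, `a₁ = b` and `a₀ a₂ - a₁² = -k²`.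
    have h1 := congrArg (eval ![c, b / c - k / c, k / c]) h
    have h2 : ∀ r : MvPolynomial (Fin 3) ℂ,
        eval (tangentParam c (b / c - k / c) (k / c)) (seminvariantSubst r) =
          eval ![c, b, -k ^ 2] r := by
      intro r
      rw [seminvariantSubst, ← coe_aeval_eq_eval, RingHom.coe_coe, ← AlgHom.comp_apply,
        comp_aeval, ← coe_aeval_eq_eval, RingHom.coe_coe]
      congr 2
      ext i
      fin_cases i
      · simp [tangentParam]
      · simp [tangentParam]; field_simp
      · simp [tangentParam, hessianLead]; field_simp; ring
    rw [eval_tangentPullback, map_add, map_mul, map_zero] at h1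
    simp only [Matrix.cons_val, h2] at h1
    have h3 : eval (tangentParam c (b / c - k / c) (k / c)) cubicovariantLead = 2 * k ^ 3 := by
      simp [tangentParam, cubicovariantLead]
      field_simp
      ring
    rwa [h3] at h1
  -- Changing the sign of `k` separates the even part `p` from the odd part `q`.
  have hp : ∀ c b k : ℂ, c ≠ 0 → eval ![c, b, -k ^ 2] p = 0 ∧
      eval ![c, b, -k ^ 2] q * k ^ 3 = 0 := by
    intro c b k hc
    have h1 := key c b k hc
    have h2 := key c b (-k) hc
    rw [neg_sq] at h2
    exact ⟨by linear_combination (h1 + h2) / 2, by linear_combination (h1 - h2) / 4⟩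
  have hy : ∀ y : Fin 3 → ℂ, ∃ k : ℂ, k ^ 2 = - y 2 ∧ y = ![y 0, y 1, -k ^ 2] := by
    intro y
    obtain ⟨k, hk⟩ := exists_sq_eq (-y 2)
    refine ⟨k, hk, ?_⟩
    ext i
    fin_cases i <;> simp [hk]
  constructor
  · refine eq_zero_of_eval_eq_zero_of_ne (X_ne_zero 0) fun y h0 => ?_
    obtain ⟨k, -, hk⟩ := hy y
    rw [hk]
    exact (hp _ _ _ (by simpa using h0)).1
  · refine eq_zero_of_eval_eq_zero_of_ne (mul_ne_zero (X_ne_zero 0) (X_ne_zero 2))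
      fun y h0 => ?_
    obtain ⟨k, hk2, hk⟩ := hy y
    simp only [map_mul, eval_X, mul_ne_zero_iff] at h0
    have hk0 : k ≠ 0 := by
      rintro rfl
      apply h0.2
      linear_combination hk2
    rw [hk]
    exact (mul_eq_zero.mp (hp _ _ _ h0.1).2).resolve_right (pow_ne_zero _ hk0)

lemma tangentPullback_invI : tangentPullback invI = 0 := by
  rw [invI_eq]
  simp only [tangentPullback, map_mul, map_add, map_sub, map_pow, map_ofNat, aeval_X, tangentParam,
    Matrix.cons_val]
  ring

lemma tangentPullback_invJ : tangentPullback invJ = 0 := by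
  rw [invJ_eq]
  simp only [tangentPullback, map_mul, map_add, map_sub, map_pow, map_ofNat, aeval_X, tangentParam,
    Matrix.cons_val]
  ring

lemma ker_tangentPullback : RingHom.ker tangentPullback = Ideal.span {invI, invJ} := by
  have hle : Ideal.span {invI, invJ} ≤ RingHom.ker tangentPullback := by
    rw [Ideal.span_le]
    rintro _ (rfl | rfl)
    · exact tangentPullback_invI
    · exact tangentPullback_invJ
  refine le_antisymm (fun f hf => ?_) hle
  obtain ⟨N, p, q, h⟩ := exists_seminvariantSubst f
  have h0 := hle h
  rw [RingHom.mem_ker] at hf h0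
  rw [map_sub, map_mul, hf, mul_zero, zero_sub, neg_eq_zero] at h0
  obtain ⟨rfl, rfl⟩ := eq_zero_of_tangentPullback h0
  rw [map_zero, zero_mul, add_zero, sub_zero] at h
  exact mem_span_pair_of_X_zero_pow_mul_mem N h

lemma isHomogeneous_invI : invI.IsHomogeneous 2 := by
  have h : invI = C 2 * (X 0 * X 4) - C 8 * (X 1 * X 3) + C 6 * X 2 ^ 2 := by
    rw [invI_eq]; simp only [C_ofNat']; ring
  have hX := isHomogeneous_X ℂ (σ := Fin 5)
  rw [h]
  exact ((((hX 0).mul (hX 4)).C_mul 2).sub (((hX 1).mul (hX 3)).C_mul 8)).add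
    (((hX 2).pow 2).C_mul 6)

lemma isHomogeneous_invJ : invJ.IsHomogeneous 3 := by
  have h : invJ = C 6 * (X 0 * X 2 * X 4) + C 12 * (X 1 * X 2 * X 3) - C 6 * X 2 ^ 3 -
      C 6 * (X 0 * X 3 ^ 2) - C 6 * (X 1 ^ 2 * X 4) := by
    rw [invJ_eq]; simp only [C_ofNat']; ring
  have hX := isHomogeneous_X ℂ (σ := Fin 5)
  rw [h]
  exact (((((((hX 0).mul (hX 2)).mul (hX 4)).C_mul 6).add
    ((((hX 1).mul (hX 2)).mul (hX 3)).C_mul 12)).sub (((hX 2).pow 3).C_mul 6)).sub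
    (((hX 0).mul ((hX 3).pow 2)).C_mul 6)).sub ((((hX 1).pow 2).mul (hX 4)).C_mul 6)

lemma mk_tangentParam_mem {c t m : ℂ} (hv : tangentParam c t m ≠ 0) :
    Projectivization.mk ℂ (tangentParam c t m) hv ∈ coincidentRootLocus 4 ![3, 1] := by
  refine ⟨_, hv, rfl, ![X 0 + C t * X 1, C c * X 0 + C (c * (t + 4 * m)) * X 1], ?_, ?_⟩
  · intro k
    have hX := isHomogeneous_X ℂ (σ := Fin 2)
    fin_cases k
    · exact (hX 0).add ((hX 1).C_mul t)
    · exact ((hX 0).C_mul c).add ((hX 1).C_mul _)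
  · rw [binaryForm_four]
    simp [tangentParam, Fin.prod_univ_two, C_ofNat]
    ring

/-- The coefficients of a form with a triple root. -/
lemma eq_of_mem_coincidentRootLocus_three_one {v : Fin 5 → ℂ} {hv : v ≠ 0}
    (h : Projectivization.mk ℂ v hv ∈ coincidentRootLocus 4 ![3, 1]) :
    ∃ s t u w : ℂ, v = ![s ^ 3 * u, 1 / 4 * (3 * s ^ 2 * t * u + s ^ 3 * w),
      1 / 2 * (s * t ^ 2 * u + s ^ 2 * t * w), 1 / 4 * (t ^ 3 * u + 3 * s * t ^ 2 * w),
      t ^ 3 * w] := by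
  obtain ⟨c, l, hl, hp⟩ := exists_binaryForm_eq_of_mem_coincidentRootLocus h
  obtain ⟨s, t, h0⟩ := isHomogeneous_one_fin_two (hl 0)
  obtain ⟨u, w, h1⟩ := isHomogeneous_one_fin_two (hl 1)
  refine ⟨s, t, c * u, c * w, binaryForm_injective 4 ?_⟩
  have h4 : (C (1 / 4 : ℂ) : MvPolynomial (Fin 2) ℂ) * 4 = 1 := by
    rw [← C_ofNat, ← C_mul]; norm_num
  have h2 : (C (1 / 2 : ℂ) : MvPolynomial (Fin 2) ℂ) * 2 = 1 := by
    rw [← C_ofNat, ← C_mul]; norm_num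
  simp only [hp, Fin.prod_univ_two, h0, h1, binaryForm_four, Matrix.cons_val]
  simp only [C_mul, C_add, C_pow, C_ofNat]
  linear_combination (-X 0 ^ 3 * X 1 * (3 * C s ^ 2 * C t * C c * C u + C s ^ 3 * C c * C w) -
    X 0 * X 1 ^ 3 * (C t ^ 3 * C c * C u + 3 * C s * C t ^ 2 * C c * C w)) * h4 -
    3 * X 0 ^ 2 * X 1 ^ 2 * (C s * C t ^ 2 * C c * C u + C s ^ 2 * C t * C c * C w) * h2

lemma projectiveIdeal_three_one_eq_ker :
    projectiveIdeal (coincidentRootLocus 4 ![3, 1]) = RingHom.ker tangentPullback := by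
  apply le_antisymm
  · rw [projectiveIdeal, Ideal.span_le]
    rintro f ⟨-, hf⟩
    refine eq_zero_of_eval_eq_zero_of_ne (X_ne_zero 0) fun y hy => ?_
    rw [eval_tangentPullback]
    have hv : tangentParam (y 0) (y 1) (y 2) ≠ 0 := fun h => hy (by
      simpa [tangentParam] using congrFun h 0)
    exact hf _ hv (mk_tangentParam_mem hv)
  · rw [ker_tangentPullback, Ideal.span_le]
    rintro _ (rfl | rfl)
    · refine mem_projectiveIdeal_of_isHomogeneous isHomogeneous_invI fun v hv h => ?_
      obtain ⟨s, t, u, w, rfl⟩ := eq_of_mem_coincidentRootLocus_three_one h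
      rw [invI_eq]
      simp only [map_mul, map_add, map_sub, map_pow, map_ofNat, eval_X, Matrix.cons_val]
      ring
    · refine mem_projectiveIdeal_of_isHomogeneous isHomogeneous_invJ fun v hv h => ?_
      obtain ⟨s, t, u, w, rfl⟩ := eq_of_mem_coincidentRootLocus_three_one h
      rw [invJ_eq]
      simp only [map_mul, map_add, map_sub, map_pow, map_ofNat, eval_X, Matrix.cons_val]
      ring

lemma isPrime_span_invI_invJ : (Ideal.span {invI, invJ}).IsPrime :=
  ker_tangentPullback ▸ RingHom.ker_isPrime _

lemma radical_span_invI_sq_invJ :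
    (Ideal.span {invI ^ 2, invJ}).radical = Ideal.span {invI, invJ} := by
  apply le_antisymm
  · rw [isPrime_span_invI_invJ.isRadical.radical_le_iff, Ideal.span_le]
    rintro _ (rfl | rfl)
    · exact Ideal.pow_mem_of_mem _ (Ideal.subset_span (by simp)) 2 two_pos
    · exact Ideal.subset_span (by simp)
  · rw [Ideal.span_le]
    rintro _ (rfl | rfl)
    · exact ⟨2, Ideal.subset_span (by simp)⟩
    · exact Ideal.le_radical (Ideal.subset_span (by simp))

/-- If `x y ∈ (i², j)` and `y ∉ (i, j)`, then `x = i u + j v`, and since `i` is prime and does not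
divide `j` even `u y ∈ (i, j)`. -/
lemma isPrimary_span_invI_sq_invJ : (Ideal.span {invI ^ 2, invJ}).IsPrimary := by
  have hP := isPrime_span_invI_invJ
  rw [Ideal.isPrimary_iff, radical_span_invI_sq_invJ]
  constructor
  · intro h
    have := radical_span_invI_sq_invJ
    rw [h, Ideal.radical_top] at this
    exact hP.ne_top this.symm
  intro x y hxy
  by_cases hy : y ∈ Ideal.span {invI, invJ}
  · exact Or.inr hy
  left
  have hle : Ideal.span {invI ^ 2, invJ} ≤ Ideal.span {invI, invJ} :=
    radical_span_invI_sq_invJ ▸ Ideal.le_radical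
  obtain ⟨u, v, rfl⟩ := Ideal.mem_span_pair.mp ((hP.mem_or_mem (hle hxy)).resolve_right hy)
  obtain ⟨a, b, hab⟩ := Ideal.mem_span_pair.mp hxy
  obtain ⟨z, hz⟩ := (prime_invI.dvd_or_dvd (a := v * y - b) (b := invJ)
    ⟨a * invI - u * y, by linear_combination -hab⟩).resolve_right not_invI_dvd_invJ
  have huy : u * y ∈ Ideal.span {invI, invJ} := by
    refine Ideal.mem_span_pair.mpr ⟨a, -z, ?_⟩
    apply mul_left_cancel₀ prime_invI.ne_zero
    linear_combination hab + invJ * hz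
  obtain ⟨p, q, hpq⟩ := Ideal.mem_span_pair.mp ((hP.mem_or_mem huy).resolve_right hy)
  exact Ideal.mem_span_pair.mpr ⟨p, q * invI + v, by rw [← hpq]; ring⟩

lemma isRegular_invI_invJ : RingTheory.Sequence.IsRegular (CoeffRing 4) [invI, invJ] := by
  refine ⟨?_, ?_⟩
  · rw [RingTheory.Sequence.isWeaklyRegular_cons_iff,
      RingTheory.Sequence.isWeaklyRegular_singleton_iff]
    constructor
    · exact IsSMulRegular.of_ne_zero prime_invI.ne_zero
    · rw [isSMulRegular_iff_right_eq_zero_of_smul]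
      intro x
      induction x using Submodule.Quotient.induction_on with
      | H f =>
        intro hf
        rw [← Submodule.Quotient.mk_smul, Submodule.Quotient.mk_eq_zero,
          Submodule.mem_smul_pointwise_iff_exists] at hf
        obtain ⟨g, -, hg⟩ := hf
        rw [smul_eq_mul, smul_eq_mul] at hg
        obtain ⟨z, rfl⟩ := (prime_invI.dvd_or_dvd ⟨g, hg.symm⟩).resolve_left not_invI_dvd_invJ
        rw [Submodule.Quotient.mk_eq_zero, Submodule.mem_smul_pointwise_iff_exists]
        exact ⟨z, trivial, rfl⟩
  · intro h
    apply isPrime_span_invI_invJ.ne_top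
    rw [h]
    simp [Ideal.ofList, Set.insert_def]

end TangentDevelopable

/-! ### Squares of quadratic forms -/

section DoubleSquares

lemma mem_of_C_mul_mem {d : ℕ} {I : Ideal (CoeffRing d)} {c : ℂ} (hc : c ≠ 0) {f : CoeffRing d}
    (h : C c * f ∈ I) : f ∈ I :=
  (Ideal.unit_mul_mem_iff_mem I ((IsUnit.mk0 c hc).map C)).mp h

/-- The substitution of the parameters `a₀, a₂, a₄`. -/
def paramSubst : MvPolynomial (Fin 3) ℂ →ₐ[ℂ] CoeffRing 4 := aeval ![X 0, X 2, X 4]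

lemma paramSubst_X (k : Fin 3) : paramSubst (X k) = ![X 0, X 2, X 4] k := aeval_X _ _

/-- Modulo the coefficients of `T`, the elements `quadE k` stand for `9 z a₀, 9 z a₂, 9 z a₄`,
where `z = p r` on the quartics `3 (p x₁² + 2 q x₁ x₂ + r x₂²)²`; the element `z` itself is not a
polynomial in the coefficients. -/
def quadE : Fin 3 → CoeffRing 4 :=
  ![3 * (3 * X 0 * X 2 - 2 * X 1 ^ 2), 2 * X 1 * X 3 + X 0 * X 4,
    3 * (3 * X 2 * X 4 - 2 * X 3 ^ 2)]

/-- The ideal generated by the coefficients of the cubicovariant. -/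
abbrev cubicovariantIdeal : Ideal (CoeffRing 4) := Ideal.span (Set.range cubicovariantCoeff)

lemma cubicovariantCoeff_mem (k : Fin 7) : cubicovariantCoeff k ∈ cubicovariantIdeal :=
  Ideal.subset_span ⟨k, rfl⟩

lemma mem_cubicovariantIdeal_of_eq {f : CoeffRing 4} (k : Fin 7) (c b : ℂ) (hc : c ≠ 0)
    (h : C c * f = C b * cubicovariantCoeff k) : f ∈ cubicovariantIdeal :=
  mem_of_C_mul_mem hc (h ▸ Ideal.mul_mem_left _ _ (cubicovariantCoeff_mem k))

lemma X_one_mul_quadE (k : Fin 3) :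
    X 1 * quadE k - 3 * X 0 * X 3 * ![X 0, X 2, X 4] k ∈ cubicovariantIdeal := by
  fin_cases k
  · refine mem_cubicovariantIdeal_of_eq 0 1 (-3) one_ne_zero ?_
    simp only [C_neg, C_ofNat', C_1, quadE, cubicovariantCoeff]
    dsimp
    ring
  · refine mem_cubicovariantIdeal_of_eq 2 5 1 (by norm_num) ?_
    simp only [C_ofNat', C_1, quadE, cubicovariantCoeff]
    dsimp
    ring
  · refine mem_cubicovariantIdeal_of_eq 4 5 3 (by norm_num) ?_
    simp only [C_ofNat', quadE, cubicovariantCoeff]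
    dsimp
    ring

lemma X_three_mul_quadE (k : Fin 3) :
    X 3 * quadE k - 3 * X 4 * X 1 * ![X 0, X 2, X 4] k ∈ cubicovariantIdeal := by
  fin_cases k
  · refine mem_cubicovariantIdeal_of_eq 2 5 (-3) (by norm_num) ?_
    simp only [C_neg, C_ofNat', quadE, cubicovariantCoeff]
    dsimp
    ring
  · refine mem_cubicovariantIdeal_of_eq 4 5 (-1) (by norm_num) ?_
    simp only [C_neg, C_ofNat', C_1, quadE, cubicovariantCoeff]
    dsimp
    ring
  · refine mem_cubicovariantIdeal_of_eq 6 1 3 one_ne_zero ?_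
    simp only [C_ofNat', C_1, quadE, cubicovariantCoeff]
    dsimp
    ring

/-- With the next two lemmas, the Koszul relations `a_k (9 z a_l) = a_l (9 z a_k)`. -/
lemma koszul_quadE_zero_one : X 2 * quadE 0 - X 0 * quadE 1 ∈ cubicovariantIdeal := by
  refine mem_cubicovariantIdeal_of_eq 1 1 (-1) one_ne_zero ?_
  simp only [C_neg, C_1, quadE, cubicovariantCoeff]
  dsimp
  ring

lemma koszul_quadE_zero_two : X 4 * quadE 0 - X 0 * quadE 2 ∈ cubicovariantIdeal := by
  refine mem_cubicovariantIdeal_of_eq 3 5 (-3) (by norm_num) ?_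
  simp only [C_neg, C_ofNat', quadE, cubicovariantCoeff]
  dsimp
  ring

lemma koszul_quadE_one_two : X 4 * quadE 1 - X 2 * quadE 2 ∈ cubicovariantIdeal := by
  refine mem_cubicovariantIdeal_of_eq 5 1 (-1) one_ne_zero ?_
  simp only [C_neg, C_1, quadE, cubicovariantCoeff]
  dsimp
  ring

/-- The combination of `1, a₁, a₃` and the `quadE k` with coefficients in `ℂ[a₀, a₂, a₄]`. -/
def normalForm (s c : Fin 3 → MvPolynomial (Fin 3) ℂ) : CoeffRing 4 :=
  paramSubst (s 0) + paramSubst (s 1) * X 1 + paramSubst (s 2) * X 3 +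
    paramSubst (c 0) * quadE 0 + paramSubst (c 1) * quadE 1 + paramSubst (c 2) * quadE 2

/-- As a module over `ℂ[a₀, a₂, a₄]`, the ring modulo the coefficients of `T` is generated by
`1, a₁, a₃` and the `quadE k`. -/
lemma exists_normalForm (f : CoeffRing 4) :
    ∃ s c : Fin 3 → MvPolynomial (Fin 3) ℂ, f - normalForm s c ∈ cubicovariantIdeal := by
  have h6 : (C (1 / 6) : CoeffRing 4) * 6 = 1 := by
    rw [← C_ofNat', ← C_mul]
    norm_num
  have hC : ∀ c : ℂ, paramSubst (C c) = C c := fun c => by simp [paramSubst, algebraMap_eq]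
  induction f using MvPolynomial.induction_on with
  | C c =>
    refine ⟨![C c, 0, 0], 0, ?_⟩
    simp [normalForm, hC]
  | add f g hf hg =>
    obtain ⟨s, c, hf⟩ := hf
    obtain ⟨s', c', hg⟩ := hg
    refine ⟨s + s', c + c', ?_⟩
    convert add_mem hf hg using 1
    simp only [normalForm, Pi.add_apply, map_add]
    ring
  | mul_X f k hf =>
    obtain ⟨s, c, hf⟩ := hf
    have hfk := Ideal.mul_mem_right (X k) _ hf
    have hmul : ∀ t : MvPolynomial (Fin 3) ℂ, f * paramSubst t -
        normalForm (fun l => s l * t) (fun l => c l * t) ∈ cubicovariantIdeal := by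
      intro t
      convert Ideal.mul_mem_right (paramSubst t) _ hf using 1
      simp only [normalForm, map_mul]
      ring
    fin_cases k
    · exact ⟨_, _, by simpa [paramSubst_X] using hmul (X 0)⟩
    · refine ⟨![9 * C (1 / 6) * X 0 * X 1 * s 1 - 3 * C (1 / 6) * X 0 * X 2 * s 2, s 0,
        3 * X 0 * (c 0 * X 0 + c 1 * X 1 + c 2 * X 2)],
        ![-C (1 / 6) * s 1, 3 * C (1 / 6) * s 2, 0], ?_⟩
      have h0 := Ideal.mul_mem_left _ (paramSubst (c 0)) (X_one_mul_quadE 0)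
      have h1 := Ideal.mul_mem_left _ (paramSubst (c 1)) (X_one_mul_quadE 1)
      have h2 := Ideal.mul_mem_left _ (paramSubst (c 2)) (X_one_mul_quadE 2)
      convert add_mem (add_mem (add_mem hfk h0) h1) h2 using 1
      simp only [normalForm, Matrix.cons_val, map_add, map_sub, map_neg, map_mul, hC, map_ofNat,
        paramSubst_X, map_zero]
      simp only [quadE]
      dsimp
      linear_combination (-(paramSubst (s 1)) * X 1 ^ 2 - paramSubst (s 2) * X 1 * X 3) * h6
    · exact ⟨_, _, by simpa [paramSubst_X] using hmul (X 1)⟩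
    · refine ⟨![9 * C (1 / 6) * X 1 * X 2 * s 2 - 3 * C (1 / 6) * X 0 * X 2 * s 1,
        3 * X 2 * (c 0 * X 0 + c 1 * X 1 + c 2 * X 2), s 0],
        ![0, 3 * C (1 / 6) * s 1, -C (1 / 6) * s 2], ?_⟩
      have h0 := Ideal.mul_mem_left _ (paramSubst (c 0)) (X_three_mul_quadE 0)
      have h1 := Ideal.mul_mem_left _ (paramSubst (c 1)) (X_three_mul_quadE 1)
      have h2 := Ideal.mul_mem_left _ (paramSubst (c 2)) (X_three_mul_quadE 2)
      convert add_mem (add_mem (add_mem hfk h0) h1) h2 using 1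
      simp only [normalForm, Matrix.cons_val, map_add, map_sub, map_neg, map_mul, hC, map_ofNat,
        paramSubst_X, map_zero]
      simp only [quadE]
      dsimp
      linear_combination (-(paramSubst (s 2)) * X 3 ^ 2 - paramSubst (s 1) * X 1 * X 3) * h6
    · exact ⟨_, _, by simpa [paramSubst_X] using hmul (X 2)⟩

/-- The coefficients of `3 (p x₁² + 2 q x₁ x₂ + r x₂²)²`. -/
def squareParam {A : Type*} [CommRing A] (p q r : A) : Fin 5 → A :=
  ![3 * p ^ 2, 3 * p * q, 2 * q ^ 2 + p * r, 3 * q * r, 3 * r ^ 2]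

/-- The pullback of polynomials under the parametrisation of squares of quadratic forms. -/
def squarePullback : CoeffRing 4 →ₐ[ℂ] MvPolynomial (Fin 3) ℂ :=
  aeval (squareParam (X 0) (X 1) (X 2))

lemma squarePullback_X (k : Fin 5) :
    squarePullback (X k) = squareParam (X 0) (X 1) (X 2) k := aeval_X _ _

lemma eval_squarePullback (y : Fin 3 → ℂ) (f : CoeffRing 4) :
    eval y (squarePullback f) = eval (squareParam (y 0) (y 1) (y 2)) f := by
  rw [squarePullback, ← coe_aeval_eq_eval, RingHom.coe_coe, ← AlgHom.comp_apply, comp_aeval,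
    ← coe_aeval_eq_eval, RingHom.coe_coe]
  congr 2
  ext k
  fin_cases k <;> simp [squareParam, map_ofNat]

lemma eval_squareParam_normalForm (p q r : ℂ) (s c : Fin 3 → MvPolynomial (Fin 3) ℂ) :
    eval (squareParam p q r) (normalForm s c) =
      eval ![3 * p ^ 2, 2 * q ^ 2 + p * r, 3 * r ^ 2] (s 0) +
      3 * q * (eval ![3 * p ^ 2, 2 * q ^ 2 + p * r, 3 * r ^ 2] (s 1) * p +
        eval ![3 * p ^ 2, 2 * q ^ 2 + p * r, 3 * r ^ 2] (s 2) * r) +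
      9 * p * r * eval ![3 * p ^ 2, 2 * q ^ 2 + p * r, 3 * r ^ 2]
        (c 0 * X 0 + c 1 * X 1 + c 2 * X 2) := by
  have h : ∀ t : MvPolynomial (Fin 3) ℂ, eval (squareParam p q r) (paramSubst t) =
      eval ![3 * p ^ 2, 2 * q ^ 2 + p * r, 3 * r ^ 2] t := by
    intro t
    rw [paramSubst, ← coe_aeval_eq_eval, RingHom.coe_coe, ← AlgHom.comp_apply,
      comp_aeval, ← coe_aeval_eq_eval, RingHom.coe_coe]
    congr 2
    ext i
    fin_cases i <;> simp [squareParam]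
  simp only [normalForm, map_add, map_mul, h]
  simp only [quadE, map_add, map_mul, map_sub, map_pow, map_ofNat, eval_X, Matrix.cons_val,
    squareParam]
  ring

/-- The functions `1, p q, q r, p r` are linearly independent over
`ℂ[p², 2 q² + p r, r²]`. -/
lemma eq_zero_of_squarePullback_normalForm {s c : Fin 3 → MvPolynomial (Fin 3) ℂ}
    (h : squarePullback (normalForm s c) = 0) :
    s = 0 ∧ c 0 * X 0 + c 1 * X 1 + c 2 * X 2 = 0 := by
  -- The signs of `q` and of `p r` are not determined by `p², m = 2 q² + p r, r²`.
  have key : ∀ p r m : ℂ, eval ![3 * p ^ 2, m, 3 * r ^ 2] (s 0) = 0 ∧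
      p * r * eval ![3 * p ^ 2, m, 3 * r ^ 2] (c 0 * X 0 + c 1 * X 1 + c 2 * X 2) = 0 ∧
      (m ^ 2 ≠ p ^ 2 * r ^ 2 → eval ![3 * p ^ 2, m, 3 * r ^ 2] (s 1) * p = 0 ∧
        eval ![3 * p ^ 2, m, 3 * r ^ 2] (s 2) * r = 0) := by
    intro p r m
    have hq : ∀ r : ℂ, ∃ q : ℂ, 2 * q ^ 2 + p * r = m := by
      intro r
      obtain ⟨q, hq⟩ := exists_sq_eq ((m - p * r) / 2)
      exact ⟨q, by rw [hq]; ring⟩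
    have hpt : ∀ q r : ℂ, 2 * q ^ 2 + p * r = m → eval ![3 * p ^ 2, m, 3 * r ^ 2] (s 0) +
      3 * q * (eval ![3 * p ^ 2, m, 3 * r ^ 2] (s 1) * p +
        eval ![3 * p ^ 2, m, 3 * r ^ 2] (s 2) * r) +
      9 * p * r * eval ![3 * p ^ 2, m, 3 * r ^ 2] (c 0 * X 0 + c 1 * X 1 + c 2 * X 2) = 0 := by
      intro q r hqr
      have h1 := congrArg (eval ![p, q, r]) h
      rw [eval_squarePullback, map_zero] at h1
      simp only [Matrix.cons_val] at h1
      rw [eval_squareParam_normalForm, hqr] at h1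
      exact h1
    obtain ⟨q₁, h₁⟩ := hq r
    obtain ⟨q₂, h₂⟩ := hq (-r)
    have e₁ := hpt q₁ r h₁
    have e₂ := hpt (-q₁) r (by rw [neg_sq]; exact h₁)
    have e₃ := hpt q₂ (-r) h₂
    have e₄ := hpt (-q₂) (-r) (by rw [neg_sq]; exact h₂)
    rw [neg_sq] at e₃ e₄
    refine ⟨by linear_combination (e₁ + e₂ + e₃ + e₄) / 4,
      by linear_combination (e₁ + e₂ - e₃ - e₄) / 36, fun hm => ?_⟩
    have hq₁ : q₁ ≠ 0 := by
      rintro rfl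
      exact hm (by rw [← h₁]; ring)
    have hq₂ : q₂ ≠ 0 := by
      rintro rfl
      exact hm (by rw [← h₂]; ring)
    have f₁ := mul_left_cancel₀ hq₁ (show q₁ * (eval ![3 * p ^ 2, m, 3 * r ^ 2] (s 1) * p +
        eval ![3 * p ^ 2, m, 3 * r ^ 2] (s 2) * r) = q₁ * 0 by
      linear_combination (e₁ - e₂) / 6)
    have f₂ := mul_left_cancel₀ hq₂ (show q₂ * (eval ![3 * p ^ 2, m, 3 * r ^ 2] (s 1) * p -
        eval ![3 * p ^ 2, m, 3 * r ^ 2] (s 2) * r) = q₂ * 0 by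
      linear_combination (e₃ - e₄) / 6)
    exact ⟨by linear_combination (f₁ + f₂) / 2, by linear_combination (f₁ - f₂) / 2⟩
  have hy : ∀ y : Fin 3 → ℂ, ∃ p r : ℂ, 3 * p ^ 2 = y 0 ∧ 3 * r ^ 2 = y 2 ∧
      y = ![3 * p ^ 2, y 1, 3 * r ^ 2] := by
    intro y
    obtain ⟨p, hp⟩ := exists_sq_eq (y 0 / 3)
    obtain ⟨r, hr⟩ := exists_sq_eq (y 2 / 3)
    have hp' : 3 * p ^ 2 = y 0 := by rw [hp]; ring
    have hr' : 3 * r ^ 2 = y 2 := by rw [hr]; ring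
    refine ⟨p, r, hp', hr', ?_⟩
    ext i
    fin_cases i <;> simp [hp', hr']
  have hd : (9 * X 1 ^ 2 - X 0 * X 2 : MvPolynomial (Fin 3) ℂ) ≠ 0 := fun h0 => by
    have := congrArg (eval ![0, 1, 0]) h0
    simp [map_ofNat] at this
  have h0 : s 0 = 0 := by
    refine eq_zero_of_eval_eq_zero_of_ne one_ne_zero fun y _ => ?_
    obtain ⟨p, r, -, -, hpr⟩ := hy y
    rw [hpr]
    exact (key p r (y 1)).1
  have h1 : s 1 = 0 := by
    refine eq_zero_of_eval_eq_zero_of_ne (mul_ne_zero (X_ne_zero 0) hd) fun y hne => ?_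
    obtain ⟨p, r, hp, hr, hpr⟩ := hy y
    simp only [map_mul, map_sub, map_pow, map_ofNat, eval_X, mul_ne_zero_iff] at hne
    have hp0 : p ≠ 0 := fun h => hne.1 (by rw [← hp, h]; ring)
    rw [hpr]
    refine (mul_eq_zero.mp ((key p r (y 1)).2.2 fun hm => hne.2 ?_).1).resolve_right hp0
    rw [hm, ← hp, ← hr]
    ring
  have h2 : s 2 = 0 := by
    refine eq_zero_of_eval_eq_zero_of_ne (mul_ne_zero (X_ne_zero 2) hd) fun y hne => ?_
    obtain ⟨p, r, hp, hr, hpr⟩ := hy y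
    simp only [map_mul, map_sub, map_pow, map_ofNat, eval_X, mul_ne_zero_iff] at hne
    have hr0 : r ≠ 0 := fun h => hne.1 (by rw [← hr, h]; ring)
    rw [hpr]
    refine (mul_eq_zero.mp ((key p r (y 1)).2.2 fun hm => hne.2 ?_).2).resolve_right hr0
    rw [hm, ← hp, ← hr]
    ring
  constructor
  · ext1 k
    fin_cases k
    · exact h0
    · exact h1
    · exact h2
  · refine eq_zero_of_eval_eq_zero_of_ne (mul_ne_zero (X_ne_zero 0) (X_ne_zero 2))
      fun y hne => ?_
    obtain ⟨p, r, hp, hr, hpr⟩ := hy y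
    simp only [map_mul, eval_X, mul_ne_zero_iff] at hne
    have hp0 : p ≠ 0 := fun h => hne.1 (by rw [← hp, h]; ring)
    have hr0 : r ≠ 0 := fun h => hne.2 (by rw [← hr, h]; ring)
    rw [hpr]
    exact (mul_eq_zero.mp (key p r (y 1)).2.1).resolve_left (mul_ne_zero hp0 hr0)

/-- Exactness of the Koszul complex of `X 0, X 1, X 2`. -/
lemma exists_koszul {c : Fin 3 → MvPolynomial (Fin 3) ℂ}
    (h : c 0 * X 0 + c 1 * X 1 + c 2 * X 2 = 0) :
    ∃ u v w, c 0 = -X 1 * w - X 2 * u ∧ c 1 = X 0 * w - X 2 * v ∧ c 2 = X 0 * u + X 1 * v := by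
  let θ : MvPolynomial (Fin 3) ℂ →ₐ[ℂ] MvPolynomial (Fin 3) ℂ := aeval ![0, 0, X 2]
  have hθ : ∀ k, θ (X k) = ![0, 0, X 2] k := fun k => aeval_X _ _
  have h2 := congrArg θ h
  simp only [map_add, map_mul, hθ, Matrix.cons_val, mul_zero, zero_add, map_zero] at h2
  have h3 : θ (c 2) = 0 := (mul_eq_zero.mp h2).resolve_right (X_ne_zero _)
  have hk : ∀ k, X k - θ (X k) ∈ Ideal.span {(X 0 : MvPolynomial (Fin 3) ℂ), X 1} := by
    intro k
    rw [hθ]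
    fin_cases k
    · simpa using Ideal.subset_span (by simp)
    · simpa using Ideal.subset_span (by simp)
    · simp
  have h4 := sub_algHom_mem_of_forall_X hk (c 2)
  rw [h3, sub_zero] at h4
  obtain ⟨u, v, huv⟩ := Ideal.mem_span_pair.mp h4
  have h5 : X 0 ∣ X 1 * (c 1 + X 2 * v) := ⟨-(c 0 + X 2 * u), by
    linear_combination h + X 2 * huv⟩
  have h01 : ¬ (X 0 : MvPolynomial (Fin 3) ℂ) ∣ X 1 := by
    rw [X_dvd_X]
    simp
  obtain ⟨w, hw⟩ := ((X_prime (R := ℂ) (i := (0 : Fin 3))).dvd_or_dvd h5).resolve_left h01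
  refine ⟨u, v, w, ?_, by linear_combination hw, by linear_combination -huv⟩
  apply mul_left_cancel₀ (X_ne_zero (R := ℂ) (0 : Fin 3))
  linear_combination h + X 2 * huv - X 1 * hw

lemma squarePullback_cubicovariantCoeff (k : Fin 7) :
    squarePullback (cubicovariantCoeff k) = 0 := by
  fin_cases k <;> simp only [cubicovariantCoeff] <;> dsimp <;>
    simp only [map_neg, map_mul, map_add, map_sub, map_pow, map_ofNat, squarePullback_X,
      squareParam, Matrix.cons_val] <;> ring

/-- A polynomial vanishing on the squares has a normal form `∑ c_k · 9 z a_k` with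
`∑ c_k a_k = 0`, and by exactness of the Koszul complex such a form lies in the ideal. -/
lemma ker_squarePullback : RingHom.ker squarePullback = cubicovariantIdeal := by
  have hle : cubicovariantIdeal ≤ RingHom.ker squarePullback := by
    rw [Ideal.span_le]
    rintro _ ⟨k, rfl⟩
    exact squarePullback_cubicovariantCoeff k
  refine le_antisymm (fun f hf => ?_) hle
  obtain ⟨s, c, h⟩ := exists_normalForm f
  have h0 := hle h
  rw [RingHom.mem_ker] at hf h0
  rw [map_sub, hf, zero_sub, neg_eq_zero] at h0
  obtain ⟨rfl, hc⟩ := eq_zero_of_squarePullback_normalForm h0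
  obtain ⟨u, v, w, h0, h1, h2⟩ := exists_koszul hc
  have hn : normalForm 0 c ∈ cubicovariantIdeal := by
    have k1 := Ideal.mul_mem_left _ (-paramSubst w) koszul_quadE_zero_one
    have k2 := Ideal.mul_mem_left _ (-paramSubst u) koszul_quadE_zero_two
    have k3 := Ideal.mul_mem_left _ (-paramSubst v) koszul_quadE_one_two
    convert add_mem (add_mem k1 k2) k3 using 1
    simp only [normalForm, h0, h1, h2, map_add, map_sub, map_neg, map_mul, paramSubst_X,
      Matrix.cons_val, Pi.zero_apply, map_zero]
    ring
  simpa using add_mem h hn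

lemma isHomogeneous_cubicovariantCoeff (k : Fin 7) : (cubicovariantCoeff k).IsHomogeneous 3 := by
  have hX := isHomogeneous_X ℂ (σ := Fin 5)
  have hm : ∀ (c : ℂ) (k l m : Fin 5), (C c * (X k * X l * X m) : CoeffRing 4).IsHomogeneous 3 :=
    fun c k l m => (((hX k).mul (hX l)).mul (hX m)).C_mul c
  have he : ∀ {f g : CoeffRing 4}, g.IsHomogeneous 3 → f = g → f.IsHomogeneous 3 :=
    fun hg h => h ▸ hg
  fin_cases k
  · refine he (((hm 1 0 0 3).sub (hm 3 0 1 2)).add (hm 2 1 1 1)) ?_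
    simp only [cubicovariantCoeff, C_ofNat', C_1]
    dsimp
    ring
  · refine he ((((hm 1 0 0 4).add (hm 2 0 1 3)).sub (hm 9 0 2 2)).add (hm 6 1 1 2)) ?_
    simp only [cubicovariantCoeff, C_ofNat', C_1]
    dsimp
    ring
  · refine he (((hm 5 0 1 4).sub (hm 15 0 2 3)).add (hm 10 1 1 3)) ?_
    simp only [cubicovariantCoeff, C_ofNat']
    dsimp
    ring
  · refine he ((hm 10 1 1 4).sub (hm 10 0 3 3)) ?_
    simp only [cubicovariantCoeff, C_ofNat']
    dsimp
    ring
  · refine he (((hm (-5) 0 3 4).add (hm 15 1 2 4)).sub (hm 10 1 3 3)) ?_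
    simp only [cubicovariantCoeff, C_ofNat', C_neg]
    dsimp
    ring
  · refine he ((((hm (-1) 0 4 4).sub (hm 2 1 3 4)).add (hm 9 2 2 4)).sub (hm 6 2 3 3)) ?_
    simp only [cubicovariantCoeff, C_ofNat', C_neg, C_1]
    dsimp
    ring
  · refine he (((hm (-1) 1 4 4).add (hm 3 2 3 4)).sub (hm 2 3 3 3)) ?_
    simp only [cubicovariantCoeff, C_ofNat', C_neg, C_1]
    dsimp
    ring

/-- The square of `p x₁² + 2 q x₁ x₂ + r x₂²` is a product of squares of linear forms, since
`p (p x₁² + 2 q x₁ x₂ + r x₂²) = (p x₁ + (q + d) x₂) (p x₁ + (q - d) x₂)` for `d² = q² - p r`. -/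
lemma mk_squareParam_mem {p q r : ℂ} (hp : p ≠ 0) (hv : squareParam p q r ≠ 0) :
    Projectivization.mk ℂ (squareParam p q r) hv ∈ coincidentRootLocus 4 ![2, 2] := by
  obtain ⟨d, hd⟩ := exists_sq_eq (q ^ 2 - p * r)
  obtain ⟨e, he⟩ := exists_sq_eq (3 / p ^ 2)
  have he' : e ^ 2 * p ^ 2 = 3 := by rw [he]; field_simp
  have hd' := congrArg (C : ℂ → MvPolynomial (Fin 2) ℂ) hd
  have he'' := congrArg (C : ℂ → MvPolynomial (Fin 2) ℂ) he'
  simp only [C_mul, C_pow, C_sub, C_ofNat] at hd' he''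
  refine ⟨_, hv, rfl, ![C e * (C p * X 0 + C (q + d) * X 1), C p * X 0 + C (q - d) * X 1], ?_, ?_⟩
  · intro k
    have hX := isHomogeneous_X ℂ (σ := Fin 2)
    fin_cases k
    · exact (((hX 0).C_mul p).add ((hX 1).C_mul _)).C_mul e
    · exact ((hX 0).C_mul p).add ((hX 1).C_mul _)
  · rw [binaryForm_four]
    simp only [squareParam, Fin.prod_univ_two, C_ofNat, C_mul, C_add, C_sub, C_pow,
      Matrix.cons_val]
    linear_combination (-(C p * X 0 ^ 2 + 2 * C q * X 0 * X 1 + C r * X 1 ^ 2) ^ 2) * he'' +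
      C e ^ 2 * X 1 ^ 2 * (2 * C p * (C p * X 0 ^ 2 + 2 * C q * X 0 * X 1 + C r * X 1 ^ 2) -
        (C d ^ 2 - (C q ^ 2 - C p * C r)) * X 1 ^ 2) * hd'

/-- The coefficients of a form with two double roots. -/
lemma eq_of_mem_coincidentRootLocus_two_two {v : Fin 5 → ℂ} {hv : v ≠ 0}
    (h : Projectivization.mk ℂ v hv ∈ coincidentRootLocus 4 ![2, 2]) :
    ∃ c p q r : ℂ, v = fun k => c * squareParam p q r k := by
  obtain ⟨c, l, hl, hp⟩ := exists_binaryForm_eq_of_mem_coincidentRootLocus h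
  obtain ⟨s, t, h0⟩ := isHomogeneous_one_fin_two (hl 0)
  obtain ⟨u, w, h1⟩ := isHomogeneous_one_fin_two (hl 1)
  -- `l₀ l₁ = s u x₁² + (s w + t u) x₁ x₂ + t w x₂²`
  refine ⟨1 / 12 * c, 2 * s * u, s * w + t * u, 2 * t * w, binaryForm_injective 4 ?_⟩
  have h12 : (C (1 / 12 : ℂ) : MvPolynomial (Fin 2) ℂ) * 12 = 1 := by
    rw [← C_ofNat, ← C_mul]; norm_num
  simp only [hp, Fin.prod_univ_two, h0, h1, binaryForm_four, Matrix.cons_val, squareParam]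
  simp only [C_mul, C_add, C_pow, C_ofNat]
  linear_combination (-C c * (C s * X 0 + C t * X 1) ^ 2 * (C u * X 0 + C w * X 1) ^ 2) * h12

lemma projectiveIdeal_two_two_eq_ker :
    projectiveIdeal (coincidentRootLocus 4 ![2, 2]) = RingHom.ker squarePullback := by
  apply le_antisymm
  · rw [projectiveIdeal, Ideal.span_le]
    rintro f ⟨-, hf⟩
    refine eq_zero_of_eval_eq_zero_of_ne (X_ne_zero 0) fun y hy => ?_
    rw [eval_squarePullback]
    rw [eval_X] at hy
    have hv : squareParam (y 0) (y 1) (y 2) ≠ 0 := fun h => hy (by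
      simpa [squareParam] using congrFun h 0)
    exact hf _ hv (mk_squareParam_mem hy hv)
  · rw [ker_squarePullback, Ideal.span_le]
    rintro _ ⟨k, rfl⟩
    refine mem_projectiveIdeal_of_isHomogeneous (isHomogeneous_cubicovariantCoeff k)
      fun v hv h => ?_
    obtain ⟨c, p, q, r, rfl⟩ := eq_of_mem_coincidentRootLocus_two_two h
    fin_cases k <;> simp only [cubicovariantCoeff] <;> dsimp <;>
      simp only [map_neg, map_mul, map_add, map_sub, map_pow, map_ofNat, eval_X,
        squareParam, Matrix.cons_val] <;> ring

end DoubleSquares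

/-! ### The Jacobian ideal of the discriminant -/

section JacobianIdeal

lemma squarePullback_invI :
    squarePullback invI = 24 * (X 0 * X 2 - X 1 ^ 2) ^ 2 := by
  rw [invI_eq]
  simp only [map_mul, map_add, map_sub, map_pow, map_ofNat, squarePullback_X, squareParam,
    Matrix.cons_val]
  ring

lemma squarePullback_invJ :
    squarePullback invJ = 48 * (X 0 * X 2 - X 1 ^ 2) ^ 3 := by
  rw [invJ_eq]
  simp only [map_mul, map_add, map_sub, map_pow, map_ofNat, squarePullback_X, squareParam,
    Matrix.cons_val]
  ring

lemma squarePullback_evectantCoeff (k : Fin 5) : squarePullback (evectantCoeff k) = 0 := by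
  have h3 : (C (1 / 3) : MvPolynomial (Fin 3) ℂ) * 3 = 1 := by
    rw [show (3 : MvPolynomial (Fin 3) ℂ) = C 3 from (map_ofNat C 3).symm, ← C_mul]
    norm_num
  have hC : squarePullback (C (1 / 3)) = C (1 / 3) := by
    rw [← algebraMap_eq, AlgHom.commutes, algebraMap_eq]
  simp only [evectantCoeff, map_sub, map_mul, map_pow, map_ofNat, squarePullback_invI,
    squarePullback_invJ]
  fin_cases k <;> simp only [hessianCoeff] <;> dsimp <;>
    simp only [map_mul, map_add, map_sub, map_pow, map_ofNat, squarePullback_X, squareParam,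
      Matrix.cons_val, hC]
  · ring
  · ring
  · linear_combination -576 * (X 0 * X 2 - X 1 ^ 2) ^ 4 * (2 * X 1 ^ 2 + X 0 * X 2) * h3
  · ring
  · ring

/-- The second-order operator `4 ∂²/∂p∂r - ∂²/∂q²` at the origin. It annihilates all quadratic
forms `p², p q, 2 q² + p r, q r, r²`, but not `p r - q²`. -/
def apolarOp (g : MvPolynomial (Fin 3) ℂ) : ℂ :=
  constantCoeff (4 * pderiv 0 (pderiv 2 g) - pderiv 1 (pderiv 1 g))

lemma apolarOp_mul (f g : MvPolynomial (Fin 3) ℂ) (hg : constantCoeff g = 0)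
    (hd : ∀ i, constantCoeff (pderiv i g) = 0) :
    apolarOp (f * g) = constantCoeff f * apolarOp g := by
  simp only [apolarOp, Derivation.leibniz, map_add, map_sub, map_mul, smul_eq_mul, hg, hd]
  ring

lemma apolarOp_squarePullback (f : CoeffRing 4) : apolarOp (squarePullback f) = 0 := by
  induction f using MvPolynomial.induction_on with
  | C c => simp [apolarOp, squarePullback, algebraMap_eq]
  | add f g hf hg =>
    simp only [apolarOp, map_add, map_sub, map_mul] at hf hg ⊢
    linear_combination hf + hg
  | mul_X f k =>
    rw [map_mul, squarePullback_X, apolarOp_mul]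
    · suffices h : apolarOp (squareParam (X 0) (X 1) (X 2) k) = 0 by rw [h, mul_zero]
      fin_cases k <;> simp [squareParam, apolarOp, Derivation.leibniz, Derivation.leibniz_pow,
        pderiv_X]
      rw [map_ofNat, map_ofNat]
      norm_num
    · fin_cases k <;> simp [squareParam]
    · intro i
      fin_cases k <;> simp [squareParam, Derivation.leibniz, Derivation.leibniz_pow]

lemma apolarOp_mul_disc (f : MvPolynomial (Fin 3) ℂ) :
    apolarOp (f * (X 0 * X 2 - X 1 ^ 2)) = 6 * constantCoeff f := by
  rw [apolarOp_mul]
  · simp [apolarOp, Derivation.leibniz, Derivation.leibniz_pow, pderiv_X]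
    rw [map_ofNat, map_ofNat]
    ring
  · simp
  · intro i
    simp [Derivation.leibniz, Derivation.leibniz_pow]

lemma mem_span_X_of_constantCoeff_eq_zero {u : CoeffRing 4} (h : constantCoeff u = 0) :
    u ∈ Ideal.span (Set.range (X : Fin 5 → CoeffRing 4)) := by
  let θ : CoeffRing 4 →ₐ[ℂ] CoeffRing 4 := aeval 0
  have hk : ∀ k, X k - θ (X k) ∈ Ideal.span (Set.range (X : Fin 5 → CoeffRing 4)) := by
    intro k
    simpa [θ] using Ideal.subset_span (Set.mem_range_self k)
  have := sub_algHom_mem_of_forall_X hk u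
  rwa [show θ u = 0 by rw [aeval_zero, h, map_zero], sub_zero] at this

/-- On squares, `i = 24 d²` and `j = 48 d³` with `d = p r - q²`. So `u i² + v j` vanishes there only
if `v = -12 d u`, and then `u` has no constant term, as `d` is not a combination of the
coefficients. -/
lemma constantCoeff_eq_zero_of_mem_ker {u v : CoeffRing 4}
    (h : squarePullback (u * invI ^ 2 + v * invJ) = 0) : constantCoeff u = 0 := by
  simp only [map_add, map_mul, map_pow, squarePullback_invI, squarePullback_invJ] at h
  have hd : (X 0 * X 2 - X 1 ^ 2 : MvPolynomial (Fin 3) ℂ) ≠ 0 := fun h0 => by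
    have := congrArg (eval ![0, 1, 0]) h0
    simp at this
  have h1 : squarePullback v = (-12 * squarePullback u) * (X 0 * X 2 - X 1 ^ 2) := by
    have h48 : (48 : MvPolynomial (Fin 3) ℂ) ≠ 0 := by norm_num
    apply mul_left_cancel₀ (mul_ne_zero h48 (pow_ne_zero 3 hd))
    linear_combination h
  have h2 := apolarOp_mul_disc (-12 * squarePullback u)
  rw [← h1, apolarOp_squarePullback] at h2
  have h3 : constantCoeff (squarePullback u) = constantCoeff u := by
    refine RingHom.congr_fun (f := constantCoeff.comp (squarePullback : CoeffRing 4 →+*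
      MvPolynomial (Fin 3) ℂ))
      (g := constantCoeff) (ringHom_ext (fun c => ?_) fun k => ?_) u
    · simp [squarePullback, algebraMap_eq]
    · fin_cases k <;> simp [squarePullback_X, squareParam]
  rw [map_mul, h3, map_neg, map_ofNat] at h2
  linear_combination (1 / 72) * h2

/-- If `u i² + v j` vanishes on the squares, then `u` has no constant term, so modulo the Jacobian
ideal it is a multiple `j w`; then `w` vanishes on the squares and `j w` is in the Jacobian
ideal. -/
lemma jacobianIdeal_eq_inf : jacobianIdeal (discriminant 4) =
    Ideal.span {invI ^ 2, invJ} ⊓ RingHom.ker squarePullback := by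
  apply le_antisymm
  · rw [jacobianIdeal_discriminant, Ideal.span_le]
    rintro _ ⟨k, rfl⟩
    refine ⟨Ideal.mem_span_pair.mpr ⟨X k, -6 * hessianCoeff k, ?_⟩, squarePullback_evectantCoeff k⟩
    rw [evectantCoeff]
    ring
  · rintro f ⟨hf, hker⟩
    obtain ⟨u, v, rfl⟩ := Ideal.mem_span_pair.mp hf
    have hJ : jacobianIdeal (discriminant 4) ≤ RingHom.ker squarePullback := by
      rw [jacobianIdeal_discriminant, Ideal.span_le]
      rintro _ ⟨k, rfl⟩
      exact squarePullback_evectantCoeff k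
    -- The generators `i² a_k - 6 j h_k` of the Jacobian ideal reduce `u i²` to a multiple of `j`.
    have hX : ∀ k, X k * invI ^ 2 ∈ jacobianIdeal (discriminant 4) ⊔ Ideal.span {invJ} := by
      intro k
      have h1 : evectantCoeff k ∈ jacobianIdeal (discriminant 4) := by
        rw [jacobianIdeal_discriminant]
        exact Ideal.subset_span ⟨k, rfl⟩
      have h2 : X k * invI ^ 2 = evectantCoeff k + (6 * hessianCoeff k) * invJ := by
        rw [evectantCoeff]
        ring
      rw [h2]
      exact add_mem (Ideal.mem_sup_left h1)
        (Ideal.mem_sup_right (Ideal.mul_mem_left _ _ (Ideal.mem_span_singleton_self _)))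
    have hu : u * invI ^ 2 ∈ jacobianIdeal (discriminant 4) ⊔ Ideal.span {invJ} := by
      refine Submodule.span_induction (p := fun u _ => u * invI ^ 2 ∈ _) ?_ (by simp) ?_ ?_
        (mem_span_X_of_constantCoeff_eq_zero (constantCoeff_eq_zero_of_mem_ker hker))
      · rintro _ ⟨k, rfl⟩
        exact hX k
      · intro x y _ _ hx hy
        rw [add_mul]
        exact add_mem hx hy
      · intro c x _ hx
        rw [smul_eq_mul, mul_assoc]
        exact Ideal.mul_mem_left _ _ hx
    obtain ⟨g, hg, h', hh', hgh⟩ := Submodule.mem_sup.mp hu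
    obtain ⟨w, rfl⟩ := Ideal.mem_span_singleton.mp hh'
    have h1 : u * invI ^ 2 + v * invJ = g + invJ * (w + v) := by
      rw [← hgh]
      ring
    rw [h1] at hker ⊢
    refine add_mem hg (invJ_mul_mem_jacobianIdeal ?_)
    rw [coeffIdeal_cubicovariant, ← cubicovariantIdeal, ← ker_squarePullback]
    have h2 : invJ * (w + v) ∈ RingHom.ker squarePullback :=
      ((RingHom.ker squarePullback).add_mem_iff_right (hJ hg)).mp hker
    refine ((RingHom.ker_isPrime squarePullback).mem_or_mem h2).resolve_left fun h0 => ?_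
    rw [RingHom.mem_ker, squarePullback_invJ] at h0
    have := congrArg (eval ![0, 1, 0]) h0
    simp [map_ofNat] at this

end JacobianIdeal

end BinaryForms

end

/-! ### The primary decomposition -/

theorem mainTheorem11 :
    -- (a1): the discriminant is defined up to a nonzero scalar
    (∃ c : ℂ, c ≠ 0 ∧
      BinaryForms.discriminant 4 = C c * (BinaryForms.invI ^ 3 - 6 * BinaryForms.invJ ^ 2)) ∧
    BinaryForms.evectant 4 6 (BinaryForms.invI ^ 3 - 6 * BinaryForms.invJ ^ 2) =
      C (BinaryForms.invI ^ 2) * BinaryForms.genericForm 4 -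
        6 * C BinaryForms.invJ * BinaryForms.hessian 4 ∧
    -- (a2)
    BinaryForms.projectiveIdeal (BinaryForms.coincidentRootLocus 4 ![3, 1]) =
      Ideal.span {BinaryForms.invI, BinaryForms.invJ} ∧
    RingTheory.Sequence.IsRegular (BinaryForms.CoeffRing 4)
      [BinaryForms.invI, BinaryForms.invJ] ∧
    BinaryForms.projectiveIdeal (BinaryForms.coincidentRootLocus 4 ![2, 2]) =
      BinaryForms.coeffIdeal (BinaryForms.cubicovariant 4) ∧
    -- (a3)
    BinaryForms.jacobianIdeal (BinaryForms.discriminant 4) =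
      Ideal.span {BinaryForms.invI ^ 2, BinaryForms.invJ} ⊓
        BinaryForms.projectiveIdeal (BinaryForms.coincidentRootLocus 4 ![2, 2]) ∧
    (BinaryForms.projectiveIdeal (BinaryForms.coincidentRootLocus 4 ![3, 1])).IsPrime ∧
    (Ideal.span {BinaryForms.invI ^ 2, BinaryForms.invJ}).IsPrimary ∧
    (Ideal.span {BinaryForms.invI ^ 2, BinaryForms.invJ}).radical =
      BinaryForms.projectiveIdeal (BinaryForms.coincidentRootLocus 4 ![3, 1]) ∧
    (BinaryForms.projectiveIdeal (BinaryForms.coincidentRootLocus 4 ![2, 2])).IsPrime ∧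
    ¬ Ideal.span {BinaryForms.invI ^ 2, BinaryForms.invJ} ≤
      BinaryForms.projectiveIdeal (BinaryForms.coincidentRootLocus 4 ![2, 2]) ∧
    ¬ BinaryForms.projectiveIdeal (BinaryForms.coincidentRootLocus 4 ![2, 2]) ≤
      Ideal.span {BinaryForms.invI ^ 2, BinaryForms.invJ} := by
  have hT := BinaryForms.projectiveIdeal_three_one_eq_ker.trans BinaryForms.ker_tangentPullback
  have hS := BinaryForms.projectiveIdeal_two_two_eq_ker
  refine ⟨⟨32, by norm_num, BinaryForms.discriminant_eq⟩, BinaryForms.evectant_eq, hT,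
    BinaryForms.isRegular_invI_invJ, ?_, ?_, ?_, BinaryForms.isPrimary_span_invI_sq_invJ, ?_, ?_,
    ?_, ?_⟩
  · rw [hS, BinaryForms.ker_squarePullback, BinaryForms.coeffIdeal_cubicovariant]
  · rw [hS, BinaryForms.jacobianIdeal_eq_inf]
  · rw [hT]
    exact BinaryForms.isPrime_span_invI_invJ
  · rw [hT, BinaryForms.radical_span_invI_sq_invJ]
  · rw [hS]
    exact RingHom.ker_isPrime _
  · rw [hS]
    intro h
    -- `i` does not vanish on the square of `x₁ x₂`.
    have h0 := h (Ideal.subset_span (Set.mem_insert _ _))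
    rw [RingHom.mem_ker, map_pow, BinaryForms.squarePullback_invI] at h0
    have := congrArg (eval ![0, 1, 0]) h0
    simp [map_ofNat] at this
  · rw [hS, BinaryForms.ker_squarePullback]
    intro h
    -- `T` does not vanish on `x₁³ x₂`.
    have h0 := BinaryForms.radical_span_invI_sq_invJ ▸
      Ideal.le_radical (h (BinaryForms.cubicovariantCoeff_mem 0))
    rw [← BinaryForms.ker_tangentPullback, RingHom.mem_ker] at h0
    have := congrArg (eval ![1, 0, 1]) h0
    rw [BinaryForms.eval_tangentPullback] at this
    simp [BinaryForms.cubicovariantCoeff, BinaryForms.tangentParam] at this
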